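/- Let $l\colon\mathbb{R}\to[0,\infty)$ be a loss function, i.e. convex and increasing (non-decreasing) with $1\in\partial l(0)$, and let $p\in[1,\infty]$. If $p<\infty$, assume in addition that $\liminf_{x\to\infty} l(x)/x>1$ and that the right derivative $l'$ of $l$ has polynomial growth of degree $p-1$: there is a constant $K$ with $l'(x)\le K(1+|x|^{p-1})$ for all $x\in\mathbb{R}$. If $p=\infty$, no growth condition is imposed. For a probability measure $\nu$ on a measurable space $\mathcal{X}$ and a measurable $f\colon\mathcal{X}\to\mathbb{R}$ set \[ \mathrm{OCE}^\nu(f):=\inf_{m\in\mathbb{R}}\Big(\int_{\mathcal{X}} l(f(x)-m)\,\nu(dx)+m\Big). \] For every $e\in\mathbb{N}_0$, $R\in\mathbb{R}$ and $a,b\ge 0$ there is a constant $C>0$, depending only on $l,p,e,R,a,b$, such that the following holds. Let $\mu$ be a probability measure on a measurable space $\mathcal{X}$, let $F,G_1,\dots,G_e\colon\mathcal{X}\to\mathbb{R}$ be measurable with $\|F\|_{L^{2p}(\mu)}\le a$ and $\big\|\sum_{i=1}^e|G_i|\big\|_{L^{2p}(\mu)}\le b$, and let $\mathcal{G}\subset\mathbb{R}^e$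 satisfy $|g|\le R$ for all $g\in\mathcal{G}$, where $|g|$ is the Euclidean norm. Let $N\ge 1$, let $X_1,\dots,X_N$ be i.i.d. random variables with law $\mu$ on some probability space, and let $\mu_N:=\frac1N\sum_{n=1}^N\delta_{X_n}$ be their empirical measure. With $g\cdot G:=\sum_{i=1}^e g_iG_i$, the supremum \[ \sup_{g\in\mathcal{G}}\big|\mathrm{OCE}^\mu(F+g\cdot G)-\mathrm{OCE}^{\mu_N}(F+g\cdot G)\big| \] (read as $0$ if $\mathcal{G}=\emptyset$) is a $[0,\infty]$-valued random variable, and \[ E\Big[\sup_{g\in\mathcal{G}}\big|\mathrm{OCE}^\mu(F+g\cdot G)-\mathrm{OCE}^{\mu_N}(F+g\cdot G)\big|\Big]\le\frac{C}{\sqrt N}. \] -/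

import Mathlib

open MeasureTheory ProbabilityTheory Set Filter
open scoped ENNReal NNReal

noncomputable section

/-- A loss function: a convex increasing function `l : ℝ → [0, ∞)` with `1 ∈ ∂l(0)`. -/
structure IsLossFunction (l : ℝ → ℝ) : Prop where
  nonneg : ∀ x, 0 ≤ l x
  monotone : Monotone l
  convex : ConvexOn ℝ univ l
  one_mem_subdifferential : ∀ x, l 0 + 1 * (x - 0) ≤ l x

/-- The right derivative of `l` has polynomial growth of degree `p - 1`, that is,
`l'(x) ≤ K (1 + |x| ^ (p - 1))` for some `K` and all `x`; no condition for `p = ∞`. -/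
def DerivHasPolynomialGrowth (l : ℝ → ℝ) (p : ℝ≥0∞) : Prop :=
  p ≠ ∞ → ∃ K : ℝ, ∀ x : ℝ, derivWithin l (Ioi x) x ≤ K * (1 + |x| ^ (p.toReal - 1))

/-- The optimized certainty equivalent `inf_m (E^ν[l(f - m)] + m)`, as an extended real number.
The expectation of the nonnegative function `l(f - m)` is taken in `[0, ∞]`. -/
def OCE {𝓧 : Type*} [MeasurableSpace 𝓧] (l : ℝ → ℝ) (ν : Measure 𝓧) (f : 𝓧 → ℝ) : EReal :=
  ⨅ m : ℝ, ((∫⁻ x, ENNReal.ofReal (l (f x - m)) ∂ν : ℝ≥0∞) : EReal) + (m : EReal)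

/-- The empirical measure `(1/N) ∑ δ_{x_n}` of a sample `x_1, …, x_N`. -/
def empiricalMeasure {𝓧 : Type*} [MeasurableSpace 𝓧] {N : ℕ} (x : Fin N → 𝓧) : Measure 𝓧 :=
  (N : ℝ≥0∞)⁻¹ • ∑ n, Measure.dirac (x n)

/-- The position `F + g · G`. -/
def hedgedPosition {𝓧 : Type*} {e : ℕ} (F : 𝓧 → ℝ) (G : Fin e → 𝓧 → ℝ)
    (g : EuclideanSpace ℝ (Fin e)) : 𝓧 → ℝ :=
  fun x => F x + ∑ i, g i * G i x

/-- The uniform estimation error `sup_{g ∈ 𝓖} |OCE^μ(F + g · G) - OCE^ν(F + g · G)| ∈ [0, ∞]`. -/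
def oceError {𝓧 : Type*} [MeasurableSpace 𝓧] {e : ℕ} (l : ℝ → ℝ) (μ ν : Measure 𝓧)
    (F : 𝓧 → ℝ) (G : Fin e → 𝓧 → ℝ) (𝓖 : Set (EuclideanSpace ℝ (Fin e))) : ℝ≥0∞ :=
  ⨆ g ∈ 𝓖, (OCE l μ (hedgedPosition F G g) - OCE l ν (hedgedPosition F G g)).abs

end

/-! The certainty equivalent is an infimum over `m` of expected losses, so once `m` is confined to a
bounded interval, its error is at most the uniform deviation of `∫ l (F + g · G - m)` over bounded
`(g, m)`. The proof bounds this deviation and treats separately the samples for which `m` cannot be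
confined.

Deviation. Let `B` be an envelope dominating every `|F + g · G - m|`. By convexity `l` is Lipschitz
on `(-∞, B]` with constant `L = l (B + 1) - l B`, so increments of the losses in `(g, m)` are
dominated by those of a linear combination of the `e + 1` functions `L` and `L * G i`, with bounded
coefficients. Symmetrization and the contraction principle then replace the losses by this
finite-dimensional linear class, with no covering numbers (`lintegral_iSup_centered_le_of_linear`).
The growth of `l'` makes `B * L` of order `B ^ p`, which is square integrable because `B` lies in
`L^{2p}`; this gives the rate `√N / N`.

Localization. If `p = ∞`, positions are essentially bounded, and since the slope of `l` is at most
`1` on the left of `0` and at least `1` on the right, `m` may be truncated to the same bound. If `p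
< ∞`, the superlinear lower bound on `l` confines `m` as soon as the mean of `S = W ^ p` is
controlled, where `W` is an envelope of the positions. Under the empirical measure this holds when
`D = ∫ S dμ_N - ∫ S dμ` satisfies `|D| ≤ 1`. When `|D| > 1`, both certainty equivalents are bounded
by the means of `S`, so the error is at most a constant times `|D|`, whose expectation is again
`O(1/√N)` (`exists_realOCE_error_bound`). -/

/-- The sign `±1` encoded by a Boolean. -/
def boolSign (b : Bool) : ℝ := if b then 1 else -1

@[simp] lemma boolSign_true : boolSign true = 1 := rfl
@[simp] lemma boolSign_false : boolSign false = -1 := rfl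

lemma boolSign_not (b : Bool) : boolSign (!b) = -boolSign b := by cases b <;> simp

lemma sum_signs_succ {n : ℕ} (f : (Fin (n + 1) → Bool) → ℝ) :
    ∑ ε, f ε = ∑ ε : Fin n → Bool, f (Fin.cons true ε) + ∑ ε : Fin n → Bool, f (Fin.cons false ε) := by
  rw [← (Fin.consEquiv (fun _ : Fin (n + 1) => Bool)).sum_comp, Fintype.sum_prod_type,
    Fintype.sum_bool]
  rfl

lemma sum_signs_neg {n : ℕ} (f : (Fin n → Bool) → ℝ) :
    ∑ ε : Fin n → Bool, f (fun i => !ε i) = ∑ ε, f ε :=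
  (Equiv.piCongrRight (fun _ : Fin n => Equiv.boolNot)).sum_comp f

/-! ### Rademacher averages and the contraction principle, as finite sums over signs. -/

section Contraction

variable {ι : Type*} [Finite ι]

lemma le_ciSup_of_finite (f : ι → ℝ) (t : ι) : f t ≤ ⨆ s, f s :=
  le_ciSup (Set.finite_range f).bddAbove t

/-- One-sign case of the contraction principle. For any pair `s`, `t` the left side contributes `c s
+ c t + (a s - a t)`, at most `c s + c t + |b s - b t|`; the right side attains this by assigning
`s` and `t` to its two suprema in the order given by the sign of `b s - b t`. -/
lemma ciSup_add_add_ciSup_sub_le [Nonempty ι] (c a b : ι → ℝ)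
    (hab : ∀ s t, |a s - a t| ≤ |b s - b t|) :
    (⨆ t, (c t + a t)) + ⨆ t, (c t - a t) ≤ (⨆ t, (c t + b t)) + ⨆ t, (c t - b t) := by
  rw [← le_sub_iff_add_le]
  refine ciSup_le fun s => ?_
  rw [le_sub_comm]
  refine ciSup_le fun t => ?_
  have h1 := le_ciSup_of_finite (fun t => c t + b t)
  have h2 := le_ciSup_of_finite (fun t => c t - b t)
  have h := (le_abs_self _).trans (hab s t)
  rcases abs_cases (b s - b t) with h' | h'
  · linarith [h1 s, h2 t]
  · linarith [h1 t, h2 s]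

/-- The contraction principle for Rademacher sums. -/
lemma sum_signs_ciSup_le_of_contraction [Nonempty ι] {n : ℕ} (c : ι → ℝ) (a b : Fin n → ι → ℝ)
    (hab : ∀ i s t, |a i s - a i t| ≤ |b i s - b i t|) :
    ∑ ε : Fin n → Bool, ⨆ t, (c t + ∑ i, boolSign (ε i) * a i t) ≤
      ∑ ε : Fin n → Bool, ⨆ t, (c t + ∑ i, boolSign (ε i) * b i t) := by
  -- The offset must vary: the term of the first sign, once contracted, is absorbed into it.
  induction n generalizing c with
  | zero => simp
  | succ n ih =>
    rw [sum_signs_succ, sum_signs_succ]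
    simp only [Fin.sum_univ_succ, Fin.cons_zero, Fin.cons_succ, boolSign_true, boolSign_false]
    have h1 := ih (fun t => c t + b 0 t) (fun i => a i.succ) (fun i => b i.succ)
      (fun i => hab i.succ)
    have h2 := ih (fun t => c t - b 0 t) (fun i => a i.succ) (fun i => b i.succ)
      (fun i => hab i.succ)
    have h3 : ∀ ε : Fin n → Bool, _ := fun ε => ciSup_add_add_ciSup_sub_le
      (fun t => c t + ∑ i, boolSign (ε i) * a i.succ t) (a 0) (b 0) (hab 0)
    have h4 := Finset.sum_le_sum (fun ε (_ : ε ∈ Finset.univ) => h3 ε)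
    simp only [Finset.sum_add_distrib] at h4
    refine le_trans (le_of_eq ?_) (h4.trans (le_trans (le_of_eq ?_) ((add_le_add h1 h2).trans
      (le_of_eq ?_))))
    all_goals
      congr 1 <;> refine Finset.sum_congr rfl fun ε _ => iSup_congr fun t => by ring

/-- The base point `t₀` makes the one-sided suprema nonnegative, so the supremum of absolute values
is at most the sum of those at `ε` and at `-ε`; flipping all signs preserves the total, whence the
factor `2`. -/
lemma sum_signs_ciSup_abs_le {n : ℕ} (a b : Fin n → ι → ℝ)
    (t₀ : ι) (ha : ∀ i, a i t₀ = 0) (hab : ∀ i s t, |a i s - a i t| ≤ |b i s - b i t|) :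
    ∑ ε : Fin n → Bool, ⨆ t, |∑ i, boolSign (ε i) * a i t| ≤
      2 * ∑ ε : Fin n → Bool, ⨆ t, ∑ i, boolSign (ε i) * b i t := by
  have : Nonempty ι := ⟨t₀⟩
  have hc := sum_signs_ciSup_le_of_contraction (fun _ => 0) a b hab
  simp only [zero_add] at hc
  set A : (Fin n → Bool) → ℝ := fun ε => ⨆ t, ∑ i, boolSign (ε i) * a i t with hA
  have hA0 : ∀ ε, 0 ≤ A ε := fun ε => by
    refine le_trans (le_of_eq ?_) (le_ciSup_of_finite _ t₀)
    simp [ha]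
  have key : ∀ ε, ⨆ t, |∑ i, boolSign (ε i) * a i t| ≤ A ε + A (fun i => !ε i) := by
    intro ε
    refine ciSup_le fun t => ?_
    have h1 : _ ≤ A ε := le_ciSup_of_finite (fun t => ∑ i, boolSign (ε i) * a i t) t
    have h2 : _ ≤ A (fun i => !ε i) :=
      le_ciSup_of_finite (fun t => ∑ i, boolSign (!ε i) * a i t) t
    simp only [boolSign_not, neg_mul, Finset.sum_neg_distrib] at h2
    rw [abs_le']
    constructor <;> linarith [hA0 ε, hA0 (fun i => !ε i)]
  calc _ ≤ ∑ ε, (A ε + A (fun i => !ε i)) := Finset.sum_le_sum fun ε _ => key ε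
    _ = 2 * ∑ ε, A ε := by rw [Finset.sum_add_distrib, sum_signs_neg A]; ring
    _ ≤ _ := by gcongr

end Contraction

/-- Orthogonality of the signs; the constant `c` collects the signs already fixed in the induction.
-/
lemma sum_signs_sq {n : ℕ} (c : ℝ) (v : Fin n → ℝ) :
    ∑ ε : Fin n → Bool, (c + ∑ i, boolSign (ε i) * v i) ^ 2 = 2 ^ n * (c ^ 2 + ∑ i, v i ^ 2) := by
  induction n generalizing c with
  | zero => simp
  | succ n ih =>
    rw [sum_signs_succ]
    simp only [Fin.sum_univ_succ, Fin.cons_zero, Fin.cons_succ, boolSign_true, boolSign_false,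
      ← add_assoc]
    rw [ih, ih]
    ring

/-- `|y| ≤ y ^ 2 / s + s` replaces Cauchy–Schwarz. The bound stays linear in the squares, so it can
be integrated before `s` is chosen. -/
lemma sum_signs_abs_le {n : ℕ} (v : Fin n → ℝ) {s : ℝ} (hs : 0 < s) :
    ∑ ε : Fin n → Bool, |∑ i, boolSign (ε i) * v i| ≤ 2 ^ n * ((∑ i, v i ^ 2) / s + s) := by
  have h := sum_signs_sq 0 v
  simp only [zero_add] at h
  have key : ∀ y : ℝ, |y| ≤ y ^ 2 / s + s := by
    intro y
    rw [div_add' _ _ _ hs.ne', le_div_iff₀ hs]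
    nlinarith [sq_nonneg (|y| - s), sq_abs y, abs_nonneg y]
  calc _ ≤ ∑ ε : Fin n → Bool, ((∑ i, boolSign (ε i) * v i) ^ 2 / s + s) :=
        Finset.sum_le_sum fun ε _ => key _
    _ = _ := by
      rw [Finset.sum_add_distrib, ← Finset.sum_div, h]
      simp
      ring

/-! ### Symmetrization by a ghost sample. -/

section Symmetrization

variable {𝓧 ι : Type*} [MeasurableSpace 𝓧] [Countable ι] {n : ℕ}

lemma integral_eval_pi (μ : Measure 𝓧) [IsProbabilityMeasure μ] {f : 𝓧 → ℝ} (hf : Measurable f)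
    (i : Fin n) : ∫ y, f (y i) ∂(Measure.pi fun _ : Fin n => μ) = ∫ x, f x ∂μ := by
  have := measurePreserving_eval (fun _ : Fin n => μ) i
  conv_rhs => rw [← this.map_eq]
  rw [integral_map this.measurable.aemeasurable hf.aestronglyMeasurable]

/-- Symmetrization, for an arbitrary choice of signs. -/
lemma lintegral_iSup_centered_le (μ : Measure 𝓧) [IsProbabilityMeasure μ] (h : ι → 𝓧 → ℝ)
    (hm : ∀ t, Measurable (h t)) (hi : ∀ t, Integrable (h t) μ) (ε : Fin n → Bool) :
    ∫⁻ x, ⨆ t, ‖∑ i, (h t (x i) - ∫ y, h t y ∂μ)‖ₑ ∂(Measure.pi fun _ : Fin n => μ) ≤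
      2 * ∫⁻ x, ⨆ t, ‖∑ i, boolSign (ε i) * h t (x i)‖ₑ ∂(Measure.pi fun _ : Fin n => μ) := by
  set π := Measure.pi fun _ : Fin n => μ with hπ
  have hmeas : ∀ t, Measurable fun z : (Fin n → 𝓧) × (Fin n → 𝓧) =>
      ‖∑ i, (h t (z.1 i) - h t (z.2 i))‖ₑ := fun t => by
    have := hm t
    fun_prop
  have hsup : Measurable fun z : (Fin n → 𝓧) × (Fin n → 𝓧) =>
      ⨆ t, ‖∑ i, (h t (z.1 i) - h t (z.2 i))‖ₑ := .iSup hmeas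
  have hA : Measurable fun x : Fin n → 𝓧 => ⨆ t, ‖∑ i, boolSign (ε i) * h t (x i)‖ₑ := by
    refine .iSup fun t => ?_
    have := hm t
    fun_prop
  have hie : ∀ t i, Integrable (fun y : Fin n → 𝓧 => h t (y i)) π := fun t i =>
    (measurePreserving_eval (fun _ : Fin n => μ) i).integrable_comp_of_integrable (hi t)
  -- The mean is an integral over an independent copy `y` of the sample, and the supremum of
  -- integrals is at most the integral of the supremum.
  have step1 : ∀ x : Fin n → 𝓧, ⨆ t, ‖∑ i, (h t (x i) - ∫ y, h t y ∂μ)‖ₑ ≤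
      ∫⁻ y, ⨆ t, ‖∑ i, (h t (x i) - h t (y i))‖ₑ ∂π := by
    intro x
    refine iSup_le fun t => ?_
    have : ∑ i, (h t (x i) - ∫ y, h t y ∂μ) = ∫ y, ∑ i, (h t (x i) - h t (y i)) ∂π := by
      rw [integral_finsetSum _ fun i _ => Integrable.sub' (integrable_const _) (hie t i)]
      refine Finset.sum_congr rfl fun i _ => ?_
      rw [integral_sub (integrable_const _) (hie t i), integral_eval_pi μ (hm t) i]
      simp
    rw [this]
    refine (enorm_integral_le_lintegral_enorm _).trans (lintegral_mono fun y => ?_)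
    exact le_iSup (fun t => ‖∑ i, (h t (x i) - h t (y i))‖ₑ) t
  have hpi := measurePreserving_arrowProdEquivProdArrow 𝓧 𝓧 (Fin n) (fun _ => μ) (fun _ => μ)
  -- Exchanging `x i` and `y i` wherever `ε i` is `false` preserves the joint law and multiplies the
  -- `i`-th difference by `boolSign (ε i)`.
  have hsw : MeasurePreserving (fun (z : Fin n → 𝓧 × 𝓧) i => if ε i then z i else (z i).swap)
      (.pi fun _ => μ.prod μ) (.pi fun _ => μ.prod μ) := by
    refine measurePreserving_pi (fun _ => μ.prod μ) (fun _ => μ.prod μ)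
      (f := fun i z => if ε i then z else z.swap) fun i => ?_
    cases ε i
    · simpa using Measure.measurePreserving_swap
    · simpa using! MeasurePreserving.id _
  have hfst : MeasurePreserving (fun (z : Fin n → 𝓧 × 𝓧) i => (z i).1) (.pi fun _ => μ.prod μ) π :=
    measurePreserving_pi (fun _ => μ.prod μ) (fun _ => μ) (f := fun _ z => z.1)
      fun _ => measurePreserving_fst
  have hsnd : MeasurePreserving (fun (z : Fin n → 𝓧 × 𝓧) i => (z i).2) (.pi fun _ => μ.prod μ) π :=
    measurePreserving_pi (fun _ => μ.prod μ) (fun _ => μ) (f := fun _ z => z.2)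
      fun _ => measurePreserving_snd
  calc _ ≤ ∫⁻ x, ∫⁻ y, ⨆ t, ‖∑ i, (h t (x i) - h t (y i))‖ₑ ∂π ∂π := lintegral_mono step1
    _ = ∫⁻ z, ⨆ t, ‖∑ i, (h t (z.1 i) - h t (z.2 i))‖ₑ ∂(π.prod π) :=
        (lintegral_prod _ hsup.aemeasurable).symm
    _ = ∫⁻ z : Fin n → 𝓧 × 𝓧, ⨆ t, ‖∑ i, (h t (z i).1 - h t (z i).2)‖ₑ ∂(.pi fun _ => μ.prod μ) :=
        (hpi.lintegral_comp hsup).symm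
    _ = ∫⁻ z : Fin n → 𝓧 × 𝓧, ⨆ t, ‖∑ i, boolSign (ε i) * (h t (z i).1 - h t (z i).2)‖ₑ
          ∂(.pi fun _ => μ.prod μ) := by
        refine (hsw.lintegral_comp (hsup.comp hpi.measurable)).symm.trans ?_
        refine lintegral_congr fun z => iSup_congr fun t => ?_
        congr 1
        refine Finset.sum_congr rfl fun i _ => ?_
        cases h' : ε i <;> simp [MeasurableEquiv.arrowProdEquivProdArrow,
          Equiv.arrowProdEquivProdArrow, h']
    _ ≤ ∫⁻ z : Fin n → 𝓧 × 𝓧, ((⨆ t, ‖∑ i, boolSign (ε i) * h t (z i).1‖ₑ) +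
          ⨆ t, ‖∑ i, boolSign (ε i) * h t (z i).2‖ₑ) ∂(.pi fun _ => μ.prod μ) := by
        refine lintegral_mono fun z => iSup_le fun t => ?_
        simp only [mul_sub, Finset.sum_sub_distrib]
        exact enorm_sub_le.trans (add_le_add
          (le_iSup (fun t => ‖∑ i, boolSign (ε i) * h t (z i).1‖ₑ) t)
          (le_iSup (fun t => ‖∑ i, boolSign (ε i) * h t (z i).2‖ₑ) t))
    _ = _ := by
        refine (lintegral_add_left (hA.comp hfst.measurable) _).trans ?_
        rw [two_mul]
        congr 1
        · exact hfst.lintegral_comp hA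
        · exact hsnd.lintegral_comp hA

end Symmetrization

/-! ### Maximal inequalities of order `√n`. -/

section MaximalInequality

variable {𝓧 : Type*} [MeasurableSpace 𝓧] {n : ℕ}

/-- Symmetrization holds for each fixed choice of signs, so it may be summed over all `2 ^ n` of
them; no probability space for the signs is needed. -/
lemma two_pow_mul_lintegral_iSup_centered_le {ι : Type*} [Finite ι]
    (μ : Measure 𝓧) [IsProbabilityMeasure μ] (h : ι → 𝓧 → ℝ)
    (hm : ∀ t, Measurable (h t)) (hi : ∀ t, Integrable (h t) μ) :
    2 ^ n * ∫⁻ x, ⨆ t, ‖∑ i, (h t (x i) - ∫ y, h t y ∂μ)‖ₑ ∂(Measure.pi fun _ : Fin n => μ) ≤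
      2 * ∫⁻ x, ENNReal.ofReal (∑ ε : Fin n → Bool, ⨆ t, |∑ i, boolSign (ε i) * h t (x i)|)
        ∂(Measure.pi fun _ : Fin n => μ) := by
  set π := Measure.pi fun _ : Fin n => μ
  have hA : ∀ ε : Fin n → Bool,
      Measurable fun x : Fin n → 𝓧 => ⨆ t, ‖∑ i, boolSign (ε i) * h t (x i)‖ₑ := fun ε => by
    refine .iSup fun t => ?_
    have := hm t
    fun_prop
  calc _ = ∑ _ε : Fin n → Bool, ∫⁻ x, ⨆ t, ‖∑ i, (h t (x i) - ∫ y, h t y ∂μ)‖ₑ ∂π := by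
        simp
    _ ≤ ∑ ε : Fin n → Bool, 2 * ∫⁻ x, ⨆ t, ‖∑ i, boolSign (ε i) * h t (x i)‖ₑ ∂π :=
        Finset.sum_le_sum fun ε _ => lintegral_iSup_centered_le μ h hm hi ε
    _ = 2 * ∫⁻ x, ∑ ε : Fin n → Bool, ⨆ t, ‖∑ i, boolSign (ε i) * h t (x i)‖ₑ ∂π := by
        rw [← Finset.mul_sum, lintegral_finsetSum _ fun ε _ => hA ε]
    _ ≤ _ := by
        gcongr with x
        rw [ENNReal.ofReal_sum_of_nonneg fun ε _ => Real.iSup_nonneg fun t => abs_nonneg _]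
        refine Finset.sum_le_sum fun ε _ => iSup_le fun t => ?_
        rw [← ofReal_norm, Real.norm_eq_abs]
        exact ENNReal.ofReal_le_ofReal
          (le_ciSup_of_finite (fun t => |∑ i, boolSign (ε i) * h t (x i)|) t)

lemma lintegral_sum_signs_abs_le (μ : Measure 𝓧) [IsProbabilityMeasure μ] {v : 𝓧 → ℝ}
    (hv : Measurable v) {σ : ℝ} (hσ : 0 < σ) (hn : 1 ≤ n)
    (hvσ : ∫⁻ x, ‖v x‖ₑ ^ 2 ∂μ ≤ ENNReal.ofReal (σ ^ 2)) :
    ∫⁻ x, ENNReal.ofReal (∑ ε : Fin n → Bool, |∑ i, boolSign (ε i) * v (x i)|)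
      ∂(Measure.pi fun _ : Fin n => μ) ≤ ENNReal.ofReal (2 ^ n * (2 * (√n * σ))) := by
  set π := Measure.pi fun _ : Fin n => μ
  have hn' : (0 : ℝ) < n := by exact_mod_cast hn
  -- The scale that balances the two terms of `sum_signs_abs_le` in expectation.
  set s := √n * σ with hs_def
  have hs : 0 < s := by positivity
  have hsq : s ^ 2 = n * σ ^ 2 := by rw [hs_def, mul_pow, Real.sq_sqrt hn'.le]
  have e1 : ∀ i : Fin n, ∫⁻ x, ‖v (x i)‖ₑ ^ 2 ∂π = ∫⁻ x, ‖v x‖ₑ ^ 2 ∂μ := fun i =>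
    (measurePreserving_eval (fun _ : Fin n => μ) i).lintegral_comp (f := fun x => ‖v x‖ₑ ^ 2) (by fun_prop)
  calc _ ≤ ∫⁻ x, (ENNReal.ofReal (2 ^ n / s) * ∑ i, ‖v (x i)‖ₑ ^ 2 +
          ENNReal.ofReal (2 ^ n * s)) ∂π := by
        refine lintegral_mono fun x => ?_
        refine (ENNReal.ofReal_le_ofReal (sum_signs_abs_le (fun i => v (x i)) hs)).trans
          (le_of_eq ?_)
        have : ∑ i, ‖v (x i)‖ₑ ^ 2 = ENNReal.ofReal (∑ i, v (x i) ^ 2) := by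
          rw [ENNReal.ofReal_sum_of_nonneg fun i _ => sq_nonneg _]
          refine Finset.sum_congr rfl fun i _ => ?_
          rw [← ofReal_norm, ← ENNReal.ofReal_pow (norm_nonneg _), Real.norm_eq_abs,
            sq_abs]
        rw [this, ← ENNReal.ofReal_mul (by positivity),
          ← ENNReal.ofReal_add (mul_nonneg (by positivity)
            (Finset.sum_nonneg fun i _ => sq_nonneg _)) (by positivity)]
        congr 1
        field_simp
    _ = ENNReal.ofReal (2 ^ n / s) * (n * ∫⁻ x, ‖v x‖ₑ ^ 2 ∂μ) + ENNReal.ofReal (2 ^ n * s) := by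
        rw [lintegral_add_right _ measurable_const, lintegral_const_mul _ (by fun_prop),
          lintegral_finsetSum _ fun i _ => by fun_prop]
        simp [e1]
    _ ≤ ENNReal.ofReal (2 ^ n / s) * (n * ENNReal.ofReal (σ ^ 2)) + ENNReal.ofReal (2 ^ n * s) := by
        gcongr
    _ = _ := by
        rw [← ENNReal.ofReal_natCast n, ← ENNReal.ofReal_mul hn'.le, ← hsq,
          ← ENNReal.ofReal_mul (by positivity), ← ENNReal.ofReal_add (by positivity)
          (by positivity)]
        congr 1
        field_simp
        ring

lemma le_of_two_pow_mul_le {I : ℝ≥0∞} {c : ℝ}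
    (h : 2 ^ n * I ≤ 2 * ENNReal.ofReal (2 ^ n * c)) : I ≤ ENNReal.ofReal (2 * c) := by
  rw [ENNReal.ofReal_mul (by positivity), ENNReal.ofReal_pow (by norm_num),
    ENNReal.ofReal_ofNat, mul_left_comm] at h
  have := (ENNReal.mul_le_mul_iff_right (pow_ne_zero n (two_ne_zero)) (by simp)).1 h
  rwa [ENNReal.ofReal_mul (by norm_num), ENNReal.ofReal_ofNat]

lemma lintegral_centered_le (μ : Measure 𝓧) [IsProbabilityMeasure μ] {v : 𝓧 → ℝ}
    (hv : Measurable v) (hi : Integrable v μ) {σ : ℝ} (hσ : 0 < σ) (hn : 1 ≤ n)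
    (hvσ : ∫⁻ x, ‖v x‖ₑ ^ 2 ∂μ ≤ ENNReal.ofReal (σ ^ 2)) :
    ∫⁻ x, ‖∑ i, (v (x i) - ∫ y, v y ∂μ)‖ₑ ∂(Measure.pi fun _ : Fin n => μ) ≤
      ENNReal.ofReal (4 * (√n * σ)) := by
  have h := two_pow_mul_lintegral_iSup_centered_le (n := n) (ι := Unit) μ (fun _ => v)
    (fun _ => hv) fun _ => hi
  simp only [ciSup_const] at h
  have := le_of_two_pow_mul_le (h.trans (by gcongr; exact lintegral_sum_signs_abs_le μ hv hσ hn hvσ))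
  refine this.trans (le_of_eq ?_)
  congr 1
  ring

/-- A maximal inequality for classes dominated by a finite-dimensional linear class. -/
lemma lintegral_iSup_centered_le_of_linear {ι J : Type*} [Finite ι] [Fintype J]
    (μ : Measure 𝓧) [IsProbabilityMeasure μ] (h : ι → 𝓧 → ℝ) (v : J → 𝓧 → ℝ) (θ : ι → J → ℝ)
    (hm : ∀ t, Measurable (h t)) (hi : ∀ t, Integrable (h t) μ) (hv : ∀ j, Measurable (v j))
    {σ ρ : ℝ} (hσ : 0 < σ) (hρ : 0 ≤ ρ) (hn : 1 ≤ n) (t₀ : ι)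
    (hlip : ∀ s t x, |h s x - h t x| ≤ |∑ j, θ s j * v j x - ∑ j, θ t j * v j x|)
    (hθ : ∀ t j, |θ t j| ≤ ρ)
    (hvσ : ∀ j, ∫⁻ x, ‖v j x‖ₑ ^ 2 ∂μ ≤ ENNReal.ofReal (σ ^ 2))
    (hσ₀ : ∫⁻ x, ‖h t₀ x‖ₑ ^ 2 ∂μ ≤ ENNReal.ofReal (σ ^ 2)) :
    ∫⁻ x, ⨆ t, ‖∑ i, (h t (x i) - ∫ y, h t y ∂μ)‖ₑ ∂(Measure.pi fun _ : Fin n => μ) ≤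
      ENNReal.ofReal ((8 * ρ * Fintype.card J + 4) * (√n * σ)) := by
  have : Nonempty ι := ⟨t₀⟩
  set π := Measure.pi fun _ : Fin n => μ
  -- Subtracting `h t₀` supplies the base point where the class vanishes; `h t₀` itself is added
  -- back at the end and costs the summand `4`.
  have h1 := two_pow_mul_lintegral_iSup_centered_le (n := n) μ (fun t x => h t x - h t₀ x)
    (fun t => (hm t).sub (hm t₀)) fun t => (hi t).sub' (hi t₀)
  have h2 : ∀ x : Fin n → 𝓧,
      ∑ ε : Fin n → Bool, ⨆ t, |∑ i, boolSign (ε i) * (h t (x i) - h t₀ (x i))| ≤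
        2 * (ρ * ∑ j, ∑ ε : Fin n → Bool, |∑ i, boolSign (ε i) * v j (x i)|) := by
    intro x
    refine (sum_signs_ciSup_abs_le (fun i t => h t (x i) - h t₀ (x i))
      (fun i t => ∑ j, θ t j * v j (x i)) t₀ (by simp) fun i s t => ?_).trans ?_
    · simpa using hlip s t (x i)
    · refine mul_le_mul_of_nonneg_left ?_ zero_le_two
      rw [Finset.sum_comm, Finset.mul_sum]
      refine Finset.sum_le_sum fun ε _ => ciSup_le fun t => ?_
      simp only [Finset.mul_sum]
      rw [Finset.sum_comm]
      refine Finset.sum_le_sum fun j _ => ?_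
      have : ∑ i, boolSign (ε i) * (θ t j * v j (x i)) =
          θ t j * ∑ i, boolSign (ε i) * v j (x i) := by
        rw [Finset.mul_sum]
        exact Finset.sum_congr rfl fun i _ => by ring
      rw [this]
      refine (le_abs_self _).trans ?_
      rw [abs_mul]
      exact mul_le_mul_of_nonneg_right (hθ t j) (abs_nonneg _)
  have h3 : ∫⁻ x, ENNReal.ofReal (∑ ε : Fin n → Bool,
      ⨆ t, |∑ i, boolSign (ε i) * (h t (x i) - h t₀ (x i))|) ∂π ≤
        ENNReal.ofReal (2 ^ n * (4 * ρ * Fintype.card J * (√n * σ))) := by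
    calc _ ≤ ∫⁻ x, ENNReal.ofReal (2 * ρ) *
          ∑ j, ENNReal.ofReal (∑ ε : Fin n → Bool, |∑ i, boolSign (ε i) * v j (x i)|) ∂π := by
          refine lintegral_mono fun x => ?_
          refine (ENNReal.ofReal_le_ofReal (h2 x)).trans (le_of_eq ?_)
          rw [← mul_assoc, ENNReal.ofReal_mul (by positivity), ENNReal.ofReal_sum_of_nonneg
            fun j _ => Finset.sum_nonneg fun ε _ => abs_nonneg _]
      _ = ENNReal.ofReal (2 * ρ) * ∑ j, ∫⁻ x,
          ENNReal.ofReal (∑ ε : Fin n → Bool, |∑ i, boolSign (ε i) * v j (x i)|) ∂π := by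
          have hmj : ∀ j, Measurable fun x : Fin n → 𝓧 =>
              ENNReal.ofReal (∑ ε : Fin n → Bool, |∑ i, boolSign (ε i) * v j (x i)|) := fun j => by
            have := hv j
            refine ENNReal.measurable_ofReal.comp (Finset.measurable_sum _ fun ε _ => ?_)
            exact Measurable.abs (by fun_prop)
          rw [lintegral_const_mul _ (Finset.measurable_sum _ fun j _ => hmj j),
            lintegral_finsetSum _ fun j _ => hmj j]
      _ ≤ ENNReal.ofReal (2 * ρ) * ∑ _j : J, ENNReal.ofReal (2 ^ n * (2 * (√n * σ))) := by
          gcongr with j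
          exact lintegral_sum_signs_abs_le μ (hv j) hσ hn (hvσ j)
      _ = _ := by
          rw [Finset.sum_const, nsmul_eq_mul, Finset.card_univ, ← ENNReal.ofReal_natCast,
            ← ENNReal.ofReal_mul (by positivity), ← ENNReal.ofReal_mul (by positivity)]
          congr 1
          ring
  have h4 := le_of_two_pow_mul_le (h1.trans (by gcongr))
  have h5 := lintegral_centered_le μ (hm t₀) (hi t₀) hσ hn hσ₀
  calc _ ≤ ∫⁻ x, ((⨆ t, ‖∑ i, (h t (x i) - h t₀ (x i) - ∫ y, (h t y - h t₀ y) ∂μ)‖ₑ) +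
        ‖∑ i, (h t₀ (x i) - ∫ y, h t₀ y ∂μ)‖ₑ) ∂π := by
        refine lintegral_mono fun x => iSup_le fun t => ?_
        refine le_trans ?_ (add_le_add_left (le_iSup
          (fun t => ‖∑ i, (h t (x i) - h t₀ (x i) - ∫ y, (h t y - h t₀ y) ∂μ)‖ₑ) t) _)
        refine le_trans (le_of_eq ?_) (enorm_add_le _ _)
        rw [← Finset.sum_add_distrib, integral_sub (hi t) (hi t₀)]
        congr 1
        exact Finset.sum_congr rfl fun i _ => by ring
    _ = _ := lintegral_add_right _ (by have := hm t₀; fun_prop)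
    _ ≤ _ := add_le_add h4 h5
    _ = _ := by
        rw [← ENNReal.ofReal_add (by positivity) (by positivity)]
        congr 1
        ring

end MaximalInequality

/-! ### Convexity estimates for the loss function. -/

namespace IsLossFunction

variable {l : ℝ → ℝ}

lemma le_convexCombo (hl : IsLossFunction l) {x y a b : ℝ} (ha : 0 ≤ a) (hb : 0 ≤ b)
    (hab : a + b = 1) : l (a * x + b * y) ≤ a * l x + b * l y :=
  hl.convex.2 (mem_univ x) (mem_univ y) ha hb hab

lemma measurable (hl : IsLossFunction l) : Measurable l := hl.monotone.measurable

lemma le_self (hl : IsLossFunction l) (x : ℝ) : x ≤ l x := by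
  linarith [hl.one_mem_subdifferential x, hl.nonneg 0]

/-- A convex function is Lipschitz on `(-∞, B]`, with a constant read off from an increment to
the right of `B`. -/
lemma abs_sub_le (hl : IsLossFunction l) {B x y : ℝ} (hx : x ≤ B) (hy : y ≤ B) :
    |l x - l y| ≤ (l (B + 1) - l B) * |x - y| := by
  wlog hxy : y ≤ x generalizing x y
  · rw [abs_sub_comm, abs_sub_comm x]
    exact this hy hx (le_of_not_ge hxy)
  rw [abs_of_nonneg (sub_nonneg.2 (hl.monotone hxy)), abs_of_nonneg (sub_nonneg.2 hxy)]
  rcases hxy.eq_or_lt with rfl | hlt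
  · simp
  have hd : 0 < x - y := sub_pos.2 hlt
  -- Chord slopes increase: the slope over `[y, x]` is at most that over `[y, B + 1]` (from `e`),
  -- which is at most that over `[B, B + 1]` (from `e'`).
  have e := hl.le_convexCombo (x := y) (y := (B + 1)) (a := 1 - (x - y) / (B + 1 - y))
    (b := (x - y) / (B + 1 - y))
    (by rw [sub_nonneg, div_le_one (by linarith)]; linarith)
    (div_nonneg hd.le (by linarith)) (by ring)
  have hne : B + 1 - y ≠ 0 := by linarith
  have p : (1 - (x - y) / (B + 1 - y)) * y + ((x - y) / (B + 1 - y)) * (B + 1) = x := by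
    field_simp; ring
  rw [p] at e
  have e' := hl.le_convexCombo (x := y) (y := (B + 1)) (a := 1 / (B + 1 - y))
    (b := 1 - 1 / (B + 1 - y)) (div_nonneg zero_le_one (by linarith))
    (by rw [sub_nonneg, div_le_one (by linarith)]; linarith) (by ring)
  have p' : (1 / (B + 1 - y)) * y + (1 - 1 / (B + 1 - y)) * (B + 1) = B := by
    field_simp; ring
  rw [p'] at e'
  have q : (x - y) / (B + 1 - y) = (x - y) * (1 / (B + 1 - y)) := by ring
  rw [q] at e
  have q1 : l x - l y ≤ (x - y) * (1 / (B + 1 - y)) * (l (B + 1) - l y) := by linarith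
  have q2 : 1 / (B + 1 - y) * (l (B + 1) - l y) ≤ l (B + 1) - l B := by linarith
  nlinarith

/-- Since `1` is a subgradient at `0`, slopes to the left of `0` are at most `1`. With
`le_sub_of_nonneg` this drives the truncation of `m` when positions are bounded. -/
lemma sub_le_of_nonpos (hl : IsLossFunction l) {x y : ℝ} (hxy : x ≤ y) (hy : y ≤ 0) : l y - l x ≤ y - x := by
  rcases hxy.eq_or_lt with rfl | hlt
  · simp
  have hx : x < 0 := hlt.trans_le hy
  have e := hl.le_convexCombo (x := x) (y := 0) (a := y / x) (b := 1 - y / x)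
    (div_nonneg_of_nonpos hy hx.le) (by rw [sub_nonneg, div_le_one_of_neg hx]; exact hxy)
    (by ring)
  have p : (y / x) * x + (1 - y / x) * (0 : ℝ) = y := by
    field_simp [hx.ne]; ring
  rw [p] at e
  have h0 := hl.one_mem_subdifferential x
  have hr : 0 ≤ 1 - y / x := by rw [sub_nonneg, div_le_one_of_neg hx]; exact hxy
  have hq : (1 - y / x) * (-x) = y - x := by field_simp [hx.ne]; ring
  nlinarith

lemma le_sub_of_nonneg (hl : IsLossFunction l) {x y : ℝ} (hxy : x ≤ y) (hx : 0 ≤ x) : y - x ≤ l y - l x := by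
  rcases hxy.eq_or_lt with rfl | hlt
  · simp
  have hy : 0 < y := hx.trans_lt hlt
  have e := hl.le_convexCombo (x := 0) (y := y) (a := 1 - x / y) (b := x / y)
    (by rw [sub_nonneg, div_le_one hy]; exact hxy) (div_nonneg hx hy.le) (by ring)
  have p : (1 - x / y) * (0 : ℝ) + (x / y) * y = x := by
    field_simp; ring
  rw [p] at e
  have h0 := hl.one_mem_subdifferential y
  have hr : 0 ≤ 1 - x / y := by rw [sub_nonneg, div_le_one hy]; exact hxy
  have hq : (1 - x / y) * y = y - x := by field_simp
  nlinarith

lemma sub_le_rightDeriv_mul (hl : IsLossFunction l) {x y : ℝ} (hxy : x < y) :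
    l y - l x ≤ derivWithin l (Ioi y) y * (y - x) := by
  have h1 := hl.convex.slope_le_leftDeriv_of_mem_interior (mem_univ x) (by simp) hxy
  have h2 := hl.convex.leftDeriv_le_rightDeriv_of_mem_interior (x := y) (by simp)
  have h3 := h1.trans h2
  rwa [slope_def_field, div_le_iff₀ (sub_pos.2 hxy)] at h3

end IsLossFunction

/-! ### Expected loss and certainty equivalent as convex functions of the parameters. -/

section Position

section Pointwise

variable {𝓧 : Type*} {e : ℕ} {F : 𝓧 → ℝ} {G : Fin e → 𝓧 → ℝ}

lemma hedgedPosition_convexCombo (g g' : EuclideanSpace ℝ (Fin e)) {α β : ℝ} (h : α + β = 1)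
    (x : 𝓧) : hedgedPosition F G (α • g + β • g') x =
      α * hedgedPosition F G g x + β * hedgedPosition F G g' x := by
  have hF : F x = α * F x + β * F x := by rw [← add_mul, h, one_mul]
  simp only [hedgedPosition, PiLp.add_apply, PiLp.smul_apply, smul_eq_mul, mul_add, Finset.mul_sum]
  rw [add_add_add_comm, ← hF, ← Finset.sum_add_distrib]
  congr 1
  exact Finset.sum_congr rfl fun i _ => by ring

/-- The bound `|F + g · G| ≤ |F| + ‖g‖ ∑ |G_i|`. -/
lemma abs_hedgedPosition_le (g : EuclideanSpace ℝ (Fin e)) (x : 𝓧) :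
    |hedgedPosition F G g x| ≤ |F x| + ‖g‖ * ∑ i, |G i x| := by
  refine (abs_add_le _ _).trans (add_le_add_right ?_ _)
  refine (Finset.abs_sum_le_sum_abs _ _).trans ?_
  rw [Finset.mul_sum]
  refine Finset.sum_le_sum fun i _ => ?_
  rw [abs_mul]
  exact mul_le_mul_of_nonneg_right (PiLp.norm_apply_le g i) (abs_nonneg _)

end Pointwise

variable {𝓧 : Type*} [MeasurableSpace 𝓧] {e : ℕ} {l : ℝ → ℝ} {ν : Measure 𝓧}
  {F : 𝓧 → ℝ} {G : Fin e → 𝓧 → ℝ}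

lemma measurable_hedgedPosition (hF : Measurable F) (hG : ∀ i, Measurable (G i))
    (g : EuclideanSpace ℝ (Fin e)) : Measurable (hedgedPosition F G g) := by
  unfold hedgedPosition
  fun_prop

/-- All positions `F + g · G` and all losses `l (F + g · G - m)` are integrable. -/
structure IntegrablePositions (l : ℝ → ℝ) (ν : Measure 𝓧) (F : 𝓧 → ℝ) (G : Fin e → 𝓧 → ℝ) :
    Prop where
  position : ∀ g, Integrable (hedgedPosition F G g) ν
  loss : ∀ g m, Integrable (fun x => l (hedgedPosition F G g x - m)) ν

/-- The expected loss `E^ν[l(F + g · G - m)]` as a real number. -/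
noncomputable def expectedLoss (l : ℝ → ℝ) (ν : Measure 𝓧) (F : 𝓧 → ℝ) (G : Fin e → 𝓧 → ℝ)
    (t : EuclideanSpace ℝ (Fin e) × ℝ) : ℝ :=
  ∫ x, l (hedgedPosition F G t.1 x - t.2) ∂ν

/-- The optimized certainty equivalent of `F + g · G` as a real number. -/
noncomputable def realOCE (l : ℝ → ℝ) (ν : Measure 𝓧) (F : 𝓧 → ℝ) (G : Fin e → 𝓧 → ℝ)
    (g : EuclideanSpace ℝ (Fin e)) : ℝ :=
  ⨅ m : ℝ, (expectedLoss l ν F G (g, m) + m)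

lemma convexOn_expectedLoss (hl : IsLossFunction l) (h : IntegrablePositions l ν F G) :
    ConvexOn ℝ univ (expectedLoss l ν F G) := by
  refine ⟨convex_univ, fun s _ t _ α β hα hβ hαβ => ?_⟩
  simp only [expectedLoss, smul_eq_mul]
  rw [← integral_const_mul, ← integral_const_mul,
    ← integral_add ((h.loss _ _).const_mul _) ((h.loss _ _).const_mul _)]
  refine integral_mono (h.loss _ _) (((h.loss _ _).const_mul _).add ((h.loss _ _).const_mul _))
    fun x => ?_
  simp only [Prod.fst_add, Prod.snd_add, Prod.smul_fst, Prod.smul_snd, smul_eq_mul]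
  rw [hedgedPosition_convexCombo _ _ hαβ]
  refine le_trans (le_of_eq ?_) (hl.le_convexCombo (x := hedgedPosition F G s.1 x - s.2)
    (y := hedgedPosition F G t.1 x - t.2) hα hβ hαβ)
  congr 1
  ring

lemma continuous_expectedLoss (hl : IsLossFunction l) (h : IntegrablePositions l ν F G) :
    Continuous (expectedLoss l ν F G) :=
  continuousOn_univ.1 ((convexOn_expectedLoss hl h).continuousOn isOpen_univ)

variable [IsProbabilityMeasure ν]

/-- From `x ≤ l x`: the mean bounds the objective below uniformly in `m`, so the real infimum is
meaningful. -/
lemma integral_position_le (hl : IsLossFunction l) (h : IntegrablePositions l ν F G)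
    (g : EuclideanSpace ℝ (Fin e)) (m : ℝ) :
    ∫ x, hedgedPosition F G g x ∂ν ≤ expectedLoss l ν F G (g, m) + m := by
  have : ∫ x, (hedgedPosition F G g x - m) ∂ν ≤ expectedLoss l ν F G (g, m) :=
    integral_mono ((h.position g).sub' (integrable_const _)) (h.loss g m) fun x => hl.le_self _
  rw [integral_sub (h.position g) (integrable_const _)] at this
  simp at this
  linarith

lemma bddBelow_expectedLoss (hl : IsLossFunction l) (h : IntegrablePositions l ν F G)
    (g : EuclideanSpace ℝ (Fin e)) :
    BddBelow (range fun m : ℝ => expectedLoss l ν F G (g, m) + m) :=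
  ⟨_, by rintro _ ⟨m, rfl⟩; exact integral_position_le hl h g m⟩

lemma realOCE_le (hl : IsLossFunction l) (h : IntegrablePositions l ν F G)
    (g : EuclideanSpace ℝ (Fin e)) (m : ℝ) :
    realOCE l ν F G g ≤ expectedLoss l ν F G (g, m) + m :=
  ciInf_le (bddBelow_expectedLoss hl h g) m

/-- Partial minimization of a jointly convex function. Near-minimizers suffice, so attainment of the
infimum is not needed. In finite dimension convexity yields continuity, which later reduces suprema
over `g` to countable sets. -/
lemma convexOn_realOCE (hl : IsLossFunction l) (h : IntegrablePositions l ν F G) :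
    ConvexOn ℝ univ (realOCE l ν F G) := by
  refine ⟨convex_univ, fun s _ t _ α β hα hβ hαβ => ?_⟩
  simp only [smul_eq_mul]
  refine le_of_forall_pos_le_add fun ε hε => ?_
  obtain ⟨m, hm⟩ := exists_lt_of_ciInf_lt (lt_add_of_pos_right (realOCE l ν F G s) hε)
  obtain ⟨k, hk⟩ := exists_lt_of_ciInf_lt (lt_add_of_pos_right (realOCE l ν F G t) hε)
  have h1 := realOCE_le hl h (α • s + β • t) (α * m + β * k)
  have h2 := (convexOn_expectedLoss hl h).2 (mem_univ (s, m)) (mem_univ (t, k)) hα hβ hαβ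
  simp only [smul_eq_mul, Prod.smul_mk, Prod.mk_add_mk] at h2
  have h3 := mul_le_mul_of_nonneg_left hm.le hα
  have h4 := mul_le_mul_of_nonneg_left hk.le hβ
  have h5 : (α + β) * ε = ε := by rw [hαβ, one_mul]
  linarith

lemma continuous_realOCE (hl : IsLossFunction l) (h : IntegrablePositions l ν F G) :
    Continuous (realOCE l ν F G) :=
  continuousOn_univ.1 ((convexOn_realOCE hl h).continuousOn isOpen_univ)

lemma OCE_eq_realOCE (hl : IsLossFunction l) (h : IntegrablePositions l ν F G)
    (g : EuclideanSpace ℝ (Fin e)) :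
    OCE l ν (hedgedPosition F G g) = (realOCE l ν F G g : EReal) := by
  have key : ∀ m : ℝ, ((∫⁻ x, ENNReal.ofReal (l (hedgedPosition F G g x - m)) ∂ν : ℝ≥0∞) : EReal)
      + (m : EReal) = ((expectedLoss l ν F G (g, m) + m : ℝ) : EReal) := by
    intro m
    have hn : ∀ x, 0 ≤ l (hedgedPosition F G g x - m) := fun x => hl.nonneg _
    rw [← ofReal_integral_eq_lintegral_ofReal (h.loss g m) (ae_of_all _ hn), EReal.coe_add,
      EReal.coe_ennreal_ofReal, max_eq_left (integral_nonneg hn)]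
    rfl
  simp only [OCE, key]
  refine le_antisymm ?_ (le_iInf fun m => EReal.coe_le_coe_iff.2 (realOCE_le hl h g m))
  refine EReal.le_of_forall_lt_iff_le.1 fun z hz => ?_
  obtain ⟨m, hm⟩ := exists_lt_of_ciInf_lt (EReal.coe_lt_coe_iff.1 hz)
  exact (iInf_le _ m).trans (EReal.coe_le_coe_iff.2 hm.le)

lemma oceError_eq {ν' : Measure 𝓧} [IsProbabilityMeasure ν'] (hl : IsLossFunction l)
    (h : IntegrablePositions l ν F G) (h' : IntegrablePositions l ν' F G)
    (𝓖 : Set (EuclideanSpace ℝ (Fin e))) :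
    oceError l ν ν' F G 𝓖 = ⨆ g ∈ 𝓖, ‖realOCE l ν F G g - realOCE l ν' F G g‖ₑ := by
  refine iSup_congr fun g => iSup_congr fun _ => ?_
  rw [OCE_eq_realOCE hl h, OCE_eq_realOCE hl h', ← EReal.coe_sub, EReal.abs_def,
    ← ofReal_norm, Real.norm_eq_abs]

end Position

lemma iSup_mem_eq_of_subset_closure {α : Type*} [TopologicalSpace α] {f : α → ℝ≥0∞}
    (hf : Continuous f) {s t : Set α} (hts : t ⊆ s) (hst : s ⊆ closure t) :
    ⨆ a ∈ s, f a = ⨆ a ∈ t, f a := by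
  refine le_antisymm (iSup₂_le fun a ha => ?_) (biSup_mono hts)
  exact closure_minimal (t := {a | f a ≤ ⨆ a ∈ t, f a}) (fun b hb => le_iSup₂ (f := fun b _ => f b) b hb)
    (isClosed_le hf continuous_const) (hst ha)

/-! ### Empirical measures and measurability of the error. -/

section Empirical

variable {𝓧 : Type*} [MeasurableSpace 𝓧] {e N : ℕ} {l : ℝ → ℝ}
  {F : 𝓧 → ℝ} {G : Fin e → 𝓧 → ℝ}

lemma isProbabilityMeasure_empiricalMeasure (hN : 1 ≤ N) (x : Fin N → 𝓧) :
    IsProbabilityMeasure (empiricalMeasure x) := by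
  refine ⟨?_⟩
  have : (N : ℝ≥0∞) ≠ 0 := by exact_mod_cast (by omega : N ≠ 0)
  simp [empiricalMeasure, ENNReal.inv_mul_cancel this]

lemma integrable_empiricalMeasure {f : 𝓧 → ℝ} (hN : 1 ≤ N) (hf : Measurable f) (x : Fin N → 𝓧) :
    Integrable f (empiricalMeasure x) := by
  refine Integrable.smul_measure ?_ (by simp; omega)
  rw [integrable_finsetSum_measure]
  intro i _
  refine ⟨hf.aestronglyMeasurable, ?_⟩
  rw [HasFiniteIntegral, lintegral_dirac' _ hf.enorm]
  exact enorm_lt_top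

lemma integral_empiricalMeasure {f : 𝓧 → ℝ} (hf : Measurable f) (x : Fin N → 𝓧) :
    ∫ y, f y ∂(empiricalMeasure x) = (N : ℝ)⁻¹ * ∑ i, f (x i) := by
  rw [empiricalMeasure, integral_smul_measure, integral_finsetSum_measure]
  · simp [integral_dirac' _ _ hf.stronglyMeasurable]
  · intro i _
    refine ⟨hf.aestronglyMeasurable, ?_⟩
    rw [HasFiniteIntegral, lintegral_dirac' _ hf.enorm]
    exact enorm_lt_top

lemma integrablePositions_empiricalMeasure (hl : IsLossFunction l) (hF : Measurable F)
    (hG : ∀ i, Measurable (G i)) (hN : 1 ≤ N) (x : Fin N → 𝓧) :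
    IntegrablePositions l (empiricalMeasure x) F G where
  position g := integrable_empiricalMeasure hN (measurable_hedgedPosition hF hG g) x
  loss g m := integrable_empiricalMeasure hN
    (hl.measurable.comp ((measurable_hedgedPosition hF hG g).sub_const m)) x

lemma measurable_realOCE_empiricalMeasure (hl : IsLossFunction l) (hF : Measurable F)
    (hG : ∀ i, Measurable (G i)) (hN : 1 ≤ N) (g : EuclideanSpace ℝ (Fin e)) :
    Measurable fun x : Fin N → 𝓧 => realOCE l (empiricalMeasure x) F G g := by
  have hm : ∀ m, Measurable fun y => l (hedgedPosition F G g y - m) := fun m =>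
    hl.measurable.comp ((measurable_hedgedPosition hF hG g).sub_const m)
  -- Continuity in `m` reduces the infimum to rational `m`, hence to countably many measurable
  -- functions of the sample.
  have key : ∀ x : Fin N → 𝓧, realOCE l (empiricalMeasure x) F G g =
      ⨅ q : range ((↑) : ℚ → ℝ),
        ((N : ℝ)⁻¹ * ∑ i, l (hedgedPosition F G g (x i) - (q : ℝ)) + (q : ℝ)) := by
    intro x
    have := isProbabilityMeasure_empiricalMeasure hN x
    have hc := continuous_expectedLoss hl (integrablePositions_empiricalMeasure hl hF hG hN x)
    have h1 : ∀ m : ℝ, expectedLoss l (empiricalMeasure x) F G (g, m) + m =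
        (N : ℝ)⁻¹ * ∑ i, l (hedgedPosition F G g (x i) - m) + m := fun m => by
      rw [expectedLoss, integral_empiricalMeasure (hm m)]
    rw [realOCE, ← Dense.ciInf' (S := range ((↑) : ℚ → ℝ)) Rat.denseRange_cast
      (f := fun m : ℝ => expectedLoss l (empiricalMeasure x) F G (g, m) + m) (by fun_prop)]
    simp_rw [h1]
  simp_rw [key]
  have : Countable (range ((↑) : ℚ → ℝ)) := (countable_range _).to_subtype
  refine .iInf fun q => ?_
  exact ((Finset.measurable_sum _ fun i _ => (hm q).comp (measurable_pi_apply i)).const_mul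
    _).add_const _

lemma measurable_oceError (hl : IsLossFunction l) (hF : Measurable F)
    (hG : ∀ i, Measurable (G i)) (hN : 1 ≤ N) {μ : Measure 𝓧} [IsProbabilityMeasure μ]
    (hμ : IntegrablePositions l μ F G) (𝓖 : Set (EuclideanSpace ℝ (Fin e))) :
    Measurable fun x : Fin N → 𝓧 => oceError l μ (empiricalMeasure x) F G 𝓖 := by
  obtain ⟨D, hDs, hDc, hD⟩ :=
    (TopologicalSpace.IsSeparable.of_separableSpace 𝓖).exists_countable_dense_subset
  have key : ∀ x : Fin N → 𝓧, oceError l μ (empiricalMeasure x) F G 𝓖 =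
      ⨆ g ∈ D, ‖realOCE l μ F G g - realOCE l (empiricalMeasure x) F G g‖ₑ := by
    intro x
    have := isProbabilityMeasure_empiricalMeasure hN x
    have hI := integrablePositions_empiricalMeasure hl hF hG hN x
    rw [oceError_eq hl hμ hI]
    refine iSup_mem_eq_of_subset_closure ?_ hDs hD
    have := continuous_realOCE hl hμ
    have := continuous_realOCE hl hI
    fun_prop
  simp_rw [key]
  refine .biSup D hDc fun g _ => ?_
  have := measurable_realOCE_empiricalMeasure hl hF hG hN g
  fun_prop

end Empirical

/-! ### Second moments from polynomial growth. -/

section Moments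

variable {𝓧 : Type*} [MeasurableSpace 𝓧] {μ : Measure 𝓧}

lemma lintegral_enorm_sq_le_of_abs_le_mul {f V : 𝓧 → ℝ} {c τ : ℝ} (hV : Measurable V)
    (hτ : ∫⁻ x, ‖V x‖ₑ ^ 2 ∂μ ≤ ENNReal.ofReal (τ ^ 2)) (hf : ∀ᵐ x ∂μ, |f x| ≤ c * V x) :
    ∫⁻ x, ‖f x‖ₑ ^ 2 ∂μ ≤ ENNReal.ofReal ((c * τ) ^ 2) := by
  calc _ ≤ ∫⁻ x, ‖c‖ₑ ^ 2 * ‖V x‖ₑ ^ 2 ∂μ := by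
        refine lintegral_mono_ae (hf.mono fun x hx => ?_)
        rw [← mul_pow, ← enorm_mul]
        gcongr
        rw [← ofReal_norm, ← ofReal_norm]
        exact ENNReal.ofReal_le_ofReal (hx.trans (le_abs_self _))
    _ = ‖c‖ₑ ^ 2 * ∫⁻ x, ‖V x‖ₑ ^ 2 ∂μ := lintegral_const_mul _ (by fun_prop)
    _ ≤ ‖c‖ₑ ^ 2 * ENNReal.ofReal (τ ^ 2) := by gcongr
    _ = _ := by
        rw [← ofReal_norm, ← ENNReal.ofReal_pow (norm_nonneg _), Real.norm_eq_abs, sq_abs,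
          ← ENNReal.ofReal_mul (sq_nonneg _), mul_pow]

lemma lintegral_enorm_le_one_add [IsProbabilityMeasure μ] (f : 𝓧 → ℝ) :
    ∫⁻ x, ‖f x‖ₑ ∂μ ≤ 1 + ∫⁻ x, ‖f x‖ₑ ^ 2 ∂μ := by
  calc _ ≤ ∫⁻ x, (1 + ‖f x‖ₑ ^ 2) ∂μ := by
        refine lintegral_mono fun x => ?_
        rcases le_total ‖f x‖ₑ 1 with h1 | h1
        · exact h1.trans le_self_add
        · exact (le_self_pow h1 two_ne_zero).trans le_add_self
    _ = _ := by
        rw [lintegral_add_left measurable_const]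
        simp

lemma integrable_of_lintegral_enorm_sq_le [IsProbabilityMeasure μ] {f : 𝓧 → ℝ} {c : ℝ}
    (hf : Measurable f) (h : ∫⁻ x, ‖f x‖ₑ ^ 2 ∂μ ≤ ENNReal.ofReal c) : Integrable f μ :=
  ⟨hf.aestronglyMeasurable, (lintegral_enorm_le_one_add f).trans_lt
    (ENNReal.add_lt_top.2 ⟨ENNReal.one_lt_top, h.trans_lt ENNReal.ofReal_lt_top⟩)⟩

/-- `(W ^ p) ^ 2 = W ^ (2 * p)`: this is where the exponent `2p` of the hypotheses is used. -/
lemma lintegral_enorm_rpow_sq_le {W : 𝓧 → ℝ} (hW : ∀ x, 0 ≤ W x) {p : ℝ≥0∞} (hp : 1 ≤ p)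
    (hp' : p ≠ ∞) {A : ℝ≥0} (hA : eLpNorm W (2 * p) μ ≤ A) :
    ∫⁻ x, ‖W x ^ p.toReal‖ₑ ^ 2 ∂μ ≤ ENNReal.ofReal (((A : ℝ) ^ p.toReal) ^ 2) := by
  have hp0 : 0 < p.toReal := ENNReal.toReal_pos (zero_lt_one.trans_le hp).ne' hp'
  have h2 : (2 * p).toReal = 2 * p.toReal := by simp
  have h0 : 0 < (2 * p).toReal := by rw [h2]; positivity
  have e : ∀ x, ‖W x ^ p.toReal‖ₑ ^ 2 = ‖W x‖ₑ ^ (2 * p).toReal := fun x => by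
    rw [Real.enorm_rpow_of_nonneg (hW x) hp0.le, h2, mul_comm, ENNReal.rpow_mul, ENNReal.rpow_two]
  simp_rw [e]
  rw [eLpNorm_eq_eLpNorm' (by simpa using (zero_lt_one.trans_le hp).ne')
    (ENNReal.mul_ne_top (by simp) hp')] at hA
  rw [lintegral_rpow_enorm_eq_rpow_eLpNorm' h0]
  refine (ENNReal.rpow_le_rpow hA h0.le).trans (le_of_eq ?_)
  rw [h2, mul_comm, ENNReal.rpow_mul, ENNReal.rpow_two, ENNReal.ofReal_pow (by positivity),
    ← ENNReal.ofReal_rpow_of_nonneg A.coe_nonneg hp0.le, ENNReal.ofReal_coe_nnreal]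

/-- Convexity gives `l w - l 0 ≤ l' w * w`, and `w ≥ 1` absorbs the lower-order terms into `w ^ q`.
-/
lemma IsLossFunction.le_mul_rpow {l : ℝ → ℝ} (hl : IsLossFunction l) {q K : ℝ} (hq : 1 ≤ q)
    (hK : ∀ x : ℝ, derivWithin l (Ioi x) x ≤ K * (1 + |x| ^ (q - 1))) {w : ℝ} (hw : 1 ≤ w) :
    l w ≤ (l 0 + 2 * |K|) * w ^ q := by
  have hw0 : 0 < w := by linarith
  have h1 := hl.sub_le_rightDeriv_mul hw0
  have h2 := hK w
  rw [abs_of_pos hw0] at h2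
  have h3 : 1 ≤ w ^ (q - 1) := Real.one_le_rpow hw (by linarith)
  have h4 : w ^ (q - 1) * w = w ^ q := by
    rw [← Real.rpow_add_one hw0.ne', sub_add_cancel]
  have h5 : 1 ≤ w ^ q := Real.one_le_rpow hw (by linarith)
  have h6 : derivWithin l (Ioi w) w ≤ 2 * |K| * w ^ (q - 1) := by
    refine h2.trans ((mul_le_mul_of_nonneg_right (le_abs_self K) (by positivity)).trans ?_)
    nlinarith [abs_nonneg K]
  have h7 := mul_le_mul_of_nonneg_right h6 hw0.le
  rw [mul_assoc, h4] at h7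
  nlinarith [hl.nonneg 0]

/-- The increment is at most `l' (w + 1)`, and `w + 1 ≤ 2 * w` turns the growth bound into a power
of `w`. The product with `w` dominates both `L` and `L * G i` in the linear class. -/
lemma IsLossFunction.mul_increment_le_mul_rpow {l : ℝ → ℝ} (hl : IsLossFunction l) {q K : ℝ}
    (hq : 1 ≤ q) (hK : ∀ x : ℝ, derivWithin l (Ioi x) x ≤ K * (1 + |x| ^ (q - 1)))
    {w : ℝ} (hw : 1 ≤ w) :
    w * (l (w + 1) - l w) ≤ 2 ^ q * |K| * w ^ q := by
  have hw0 : 0 < w := by linarith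
  have h1 := hl.sub_le_rightDeriv_mul (lt_add_one w)
  rw [add_sub_cancel_left, mul_one] at h1
  have h2 := hK (w + 1)
  rw [abs_of_pos (by linarith)] at h2
  have h3 : 1 ≤ (w + 1) ^ (q - 1) := Real.one_le_rpow (by linarith) (by linarith)
  have h8 : (w + 1) ^ (q - 1) ≤ (2 * w) ^ (q - 1) :=
    Real.rpow_le_rpow (by linarith) (by linarith) (by linarith)
  have h9 : 2 * (2 * w) ^ (q - 1) * w = 2 ^ q * w ^ q := by
    rw [← Real.mul_rpow zero_le_two hw0.le, ← sub_add_cancel q 1,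
      Real.rpow_add_one (by positivity), add_sub_cancel_right]
    ring
  have h6 : l (w + 1) - l w ≤ |K| * (2 * (2 * w) ^ (q - 1)) := by
    refine (h1.trans h2).trans ((mul_le_mul_of_nonneg_right (le_abs_self K) (by positivity)).trans
      (mul_le_mul_of_nonneg_left (by linarith) (abs_nonneg K)))
  have h7 := mul_le_mul_of_nonneg_right h6 hw0.le
  linarith [h9 ▸ (show |K| * (2 * (2 * w) ^ (q - 1)) * w = |K| * (2 * (2 * w) ^ (q - 1) * w) by ring)]

end Moments

/-- Uniform second moment bounds for `l ∘ W` and `W · (l (W + 1) - l W)`. -/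
lemma exists_loss_moment_bound {l : ℝ → ℝ} (hl : IsLossFunction l) {p : ℝ≥0∞} (hp : 1 ≤ p)
    (hderiv : DerivHasPolynomialGrowth l p) (A : ℝ≥0) :
    ∃ σ : ℝ, 0 < σ ∧ ∀ (𝓧 : Type*) [MeasurableSpace 𝓧] (μ : Measure 𝓧) [IsProbabilityMeasure μ]
      (W : 𝓧 → ℝ), Measurable W → (∀ x, 1 ≤ W x) → eLpNorm W (2 * p) μ ≤ A →
      ∫⁻ x, ‖l (W x)‖ₑ ^ 2 ∂μ ≤ ENNReal.ofReal (σ ^ 2) ∧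
      ∫⁻ x, ‖W x * (l (W x + 1) - l (W x))‖ₑ ^ 2 ∂μ ≤ ENNReal.ofReal (σ ^ 2) := by
  have hinc : ∀ {w : ℝ}, 1 ≤ w → 0 ≤ w * (l (w + 1) - l w) := fun {w} hw =>
    mul_nonneg (by linarith) (sub_nonneg.2 (hl.monotone (by linarith)))
  rcases eq_or_ne p ∞ with rfl | hp'
  -- For `p = ∞` the function `W` is essentially bounded by `A`, so monotonicity of `l` gives
  -- constant bounds.
  · set c := l A + A * l (A + 1) + 1
    have hc1 : 0 ≤ l A := hl.nonneg _
    have hc2 : 0 ≤ A * l (A + 1) := mul_nonneg A.2 (hl.nonneg _)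
    refine ⟨c * 1, by positivity, fun 𝓧 _ μ _ W hW hW1 hA => ?_⟩
    rw [ENNReal.mul_top two_ne_zero, eLpNorm_exponent_top] at hA
    have hae : ∀ᵐ x ∂μ, W x ≤ A := by
      filter_upwards [ae_le_eLpNormEssSup (f := W) (μ := μ)] with x hx
      have := hx.trans hA
      rw [← ofReal_norm, ← ENNReal.ofReal_coe_nnreal] at this
      exact (le_abs_self _).trans ((ENNReal.ofReal_le_ofReal_iff A.2).1 this)
    have hV : ∫⁻ x : 𝓧, ‖(1 : ℝ)‖ₑ ^ 2 ∂μ ≤ ENNReal.ofReal (1 ^ 2) := by simp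
    constructor
    · refine lintegral_enorm_sq_le_of_abs_le_mul measurable_const hV (hae.mono fun x hx => ?_)
      rw [abs_of_nonneg (hl.nonneg _), mul_one]
      linarith [hl.monotone hx]
    · refine lintegral_enorm_sq_le_of_abs_le_mul measurable_const hV (hae.mono fun x hx => ?_)
      rw [abs_of_nonneg (hinc (hW1 x)), mul_one]
      have h1 : l (W x + 1) - l (W x) ≤ l (A + 1) := by
        linarith [hl.nonneg (W x), hl.monotone (show W x + 1 ≤ A + 1 by linarith)]
      have h2 := mul_le_mul hx h1 (sub_nonneg.2 (hl.monotone (by linarith))) A.2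
      linarith
  · obtain ⟨K, hK⟩ := hderiv hp'
    have hq : 1 ≤ p.toReal := by
      rw [← ENNReal.toReal_one]
      exact ENNReal.toReal_mono hp' hp
    set q := p.toReal
    set c := l 0 + 2 * |K| + 2 ^ q * |K| + 1
    have hl0 := hl.nonneg 0
    have hc : 0 < c := by positivity
    have hc1 : l 0 + 2 * |K| ≤ c := by
      have : (0 : ℝ) ≤ 2 ^ q * |K| := by positivity
      linarith
    have hc2 : 2 ^ q * |K| ≤ c := by linarith [abs_nonneg K]
    refine ⟨c * ((A : ℝ) ^ q + 1), by positivity, fun 𝓧 _ μ _ W hW hW1 hA => ?_⟩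
    have hV : ∫⁻ x, ‖W x ^ q‖ₑ ^ 2 ∂μ ≤ ENNReal.ofReal (((A : ℝ) ^ q + 1) ^ 2) :=
      (lintegral_enorm_rpow_sq_le (fun x => zero_le_one.trans (hW1 x)) hp hp' hA).trans
        (ENNReal.ofReal_le_ofReal (by gcongr; linarith))
    have hVm : Measurable fun x => W x ^ q := by fun_prop
    have hpos : ∀ x, 0 ≤ W x ^ q := fun x => Real.rpow_nonneg (zero_le_one.trans (hW1 x)) _
    constructor
    · refine lintegral_enorm_sq_le_of_abs_le_mul hVm hV (ae_of_all _ fun x => ?_)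
      rw [abs_of_nonneg (hl.nonneg _)]
      exact (hl.le_mul_rpow hq hK (hW1 x)).trans (mul_le_mul_of_nonneg_right hc1 (hpos x))
    · refine lintegral_enorm_sq_le_of_abs_le_mul hVm hV (ae_of_all _ fun x => ?_)
      rw [abs_of_nonneg (hinc (hW1 x))]
      exact (hl.mul_increment_le_mul_rpow hq hK (hW1 x)).trans
        (mul_le_mul_of_nonneg_right hc2 (hpos x))

/-- The envelope `|F| + r ∑ |G_i| + c`. -/
def envelope {𝓧 : Type*} {e : ℕ} (F : 𝓧 → ℝ) (G : Fin e → 𝓧 → ℝ) (r c : ℝ≥0) : 𝓧 → ℝ :=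
  fun x => |F x| + r * ∑ i, |G i x| + c

/-! ### The envelope dominating all positions. -/

section Envelope

variable {𝓧 : Type*} {e : ℕ} {F : 𝓧 → ℝ} {G : Fin e → 𝓧 → ℝ}

lemma sum_abs_nonneg (G : Fin e → 𝓧 → ℝ) (x : 𝓧) : 0 ≤ ∑ i, |G i x| :=
  Finset.sum_nonneg fun _ _ => abs_nonneg _

lemma one_le_envelope {r c : ℝ≥0} (hc : 1 ≤ c) (x : 𝓧) : 1 ≤ envelope F G r c x := by
  have h1 := mul_nonneg r.coe_nonneg (sum_abs_nonneg G x)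
  have h2 : (1 : ℝ) ≤ c := by exact_mod_cast hc
  have h3 := abs_nonneg (F x)
  unfold envelope
  linarith

lemma abs_hedgedPosition_sub_le_envelope {r c : ℝ≥0} {g : EuclideanSpace ℝ (Fin e)} {m : ℝ}
    (hg : ‖g‖ ≤ r) (hm : |m| ≤ c) (x : 𝓧) :
    |hedgedPosition F G g x - m| ≤ envelope F G r c x := by
  have h1 := abs_hedgedPosition_le (F := F) (G := G) g x
  have h2 := mul_le_mul_of_nonneg_right hg (sum_abs_nonneg G x)
  have h3 := abs_sub (hedgedPosition F G g x) m
  unfold envelope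
  linarith

lemma abs_le_envelope {r c : ℝ≥0} (hr : 1 ≤ r) (i : Fin e) (x : 𝓧) :
    |G i x| ≤ envelope F G r c x := by
  have h1 : |G i x| ≤ ∑ i, |G i x| :=
    Finset.single_le_sum (f := fun i => |G i x|) (fun _ _ => abs_nonneg _) (Finset.mem_univ i)
  have h2 : (1 : ℝ) ≤ r := by exact_mod_cast hr
  have h3 := mul_le_mul_of_nonneg_right h2 (sum_abs_nonneg G x)
  have h4 := abs_nonneg (F x)
  have h5 := c.coe_nonneg
  unfold envelope
  linarith

variable [MeasurableSpace 𝓧]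

lemma measurable_envelope (hF : Measurable F) (hG : ∀ i, Measurable (G i)) (r c : ℝ≥0) :
    Measurable (envelope F G r c) := by
  have h1 : Measurable fun x => |F x| := hF.abs
  have h2 : ∀ i, Measurable fun x => |G i x| := fun i => (hG i).abs
  unfold envelope
  fun_prop

lemma eLpNorm_envelope_le {μ : Measure 𝓧} [IsProbabilityMeasure μ] {p : ℝ≥0∞} (hp : 1 ≤ p)
    (hF : Measurable F) (hG : ∀ i, Measurable (G i)) {a b : ℝ≥0} (ha : eLpNorm F p μ ≤ a)
    (hb : eLpNorm (fun x => ∑ i, |G i x|) p μ ≤ b) (r c : ℝ≥0) :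
    eLpNorm (envelope F G r c) p μ ≤ (a + r * b + c : ℝ≥0) := by
  have h1 : Measurable fun x => |F x| := hF.abs
  have h2 : ∀ i, Measurable fun x => |G i x| := fun i => (hG i).abs
  have h3 : Measurable fun x => ∑ i, |G i x| := by fun_prop
  have e1 : eLpNorm (fun x => |F x|) p μ ≤ a := by
    rwa [eLpNorm_congr_norm_ae (g := F) (ae_of_all _ fun x => by simp)]
  have e2 : eLpNorm (fun x => r * ∑ i, |G i x|) p μ ≤ r * b := by
    have := eLpNorm_const_smul_le (p := p) (μ := μ) (c := (r : ℝ)) (f := fun x => ∑ i, |G i x|)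
    refine this.trans ?_
    rw [show ‖(r : ℝ)‖ₑ = r by simp]
    gcongr
  have e3 : eLpNorm (fun _ : 𝓧 => (c : ℝ)) p μ ≤ c := by
    rw [eLpNorm_const _ (zero_lt_one.trans_le hp).ne' (IsProbabilityMeasure.ne_zero μ)]
    simp
  push_cast
  refine (eLpNorm_add_le (f := fun x => |F x| + r * ∑ i, |G i x|) (g := fun _ => (c : ℝ))
    (by fun_prop) (by fun_prop) hp).trans (add_le_add ?_ e3)
  exact (eLpNorm_add_le (f := fun x => |F x|) (g := fun x => r * ∑ i, |G i x|)
    (by fun_prop) (by fun_prop) hp).trans (add_le_add e1 e2)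

lemma integrablePositions_of_eLpNorm_le {l : ℝ → ℝ} (hl : IsLossFunction l) {p : ℝ≥0∞}
    (hp : 1 ≤ p) (hderiv : DerivHasPolynomialGrowth l p) {a b : ℝ≥0} {μ : Measure 𝓧}
    [IsProbabilityMeasure μ] (hF : Measurable F) (hG : ∀ i, Measurable (G i))
    (ha : eLpNorm F (2 * p) μ ≤ a) (hb : eLpNorm (fun x => ∑ i, |G i x|) (2 * p) μ ≤ b) :
    IntegrablePositions l μ F G := by
  have hp2 : 1 ≤ 2 * p := hp.trans (le_mul_of_one_le_left zero_le one_le_two)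
  have key : ∀ (r c : ℝ≥0), 1 ≤ c → Integrable (fun x => l (envelope F G r c x)) μ := by
    intro r c hc
    obtain ⟨σ, -, hσ⟩ := exists_loss_moment_bound hl hp hderiv (a + r * b + c)
    have hm := measurable_envelope hF hG r c
    exact integrable_of_lintegral_enorm_sq_le (hl.measurable.comp hm)
      (hσ 𝓧 μ _ hm (one_le_envelope hc) (eLpNorm_envelope_le hp2 hF hG ha hb r c)).1
  constructor
  · intro g
    refine (key ‖g‖₊ 1 le_rfl).mono' (measurable_hedgedPosition hF hG g).aestronglyMeasurable
      (ae_of_all _ fun x => ?_)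
    have := abs_hedgedPosition_sub_le_envelope (F := F) (G := G) (r := ‖g‖₊) (c := 1) (g := g)
      (m := 0) le_rfl (by simp) x
    rw [sub_zero] at this
    exact this.trans (hl.le_self _)
  · intro g m
    refine (key ‖g‖₊ (‖m‖₊ + 1) le_add_self).mono' (hl.measurable.comp
      ((measurable_hedgedPosition hF hG g).sub_const m)).aestronglyMeasurable
      (ae_of_all _ fun x => ?_)
    rw [Real.norm_eq_abs, abs_of_nonneg (hl.nonneg _)]
    exact hl.monotone ((le_abs_self _).trans
      (abs_hedgedPosition_sub_le_envelope (by simp) (by simp) x))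

end Envelope

/-! ### Uniform deviation of expected losses over bounded parameters. -/

/-- A maximal inequality for the losses `l (F + g · G - m)` over a finite set of parameters. -/
lemma exists_finite_loss_maximal_bound {l : ℝ → ℝ} (hl : IsLossFunction l) {p : ℝ≥0∞}
    (hp : 1 ≤ p) (hderiv : DerivHasPolynomialGrowth l p) (e : ℕ) (a b ρ : ℝ≥0) (hρ : 1 ≤ ρ) :
    ∃ C : ℝ, 0 < C ∧ ∀ (𝓧 : Type*) [MeasurableSpace 𝓧] (μ : Measure 𝓧) [IsProbabilityMeasure μ]
      (F : 𝓧 → ℝ) (G : Fin e → 𝓧 → ℝ), Measurable F → (∀ i, Measurable (G i)) →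
      eLpNorm F (2 * p) μ ≤ a → eLpNorm (fun x => ∑ i, |G i x|) (2 * p) μ ≤ b →
      ∀ (N : ℕ), 1 ≤ N → ∀ (ι : Type) [Finite ι] (θ : ι → EuclideanSpace ℝ (Fin e) × ℝ) (t₀ : ι),
      θ t₀ = 0 → (∀ t, ‖(θ t).1‖ ≤ ρ) → (∀ t, |(θ t).2| ≤ ρ) →
      ∫⁻ x, ⨆ t, ‖∑ i, (l (hedgedPosition F G (θ t).1 (x i) - (θ t).2) -
        expectedLoss l μ F G (θ t))‖ₑ ∂(Measure.pi fun _ : Fin N => μ) ≤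
        ENNReal.ofReal (C * √N) := by
  have hp2 : 1 ≤ 2 * p := hp.trans (le_mul_of_one_le_left zero_le one_le_two)
  obtain ⟨σ, hσ, hmom⟩ := exists_loss_moment_bound hl hp hderiv (a + ρ * b + ρ)
  refine ⟨(8 * ρ * (e + 1) + 4) * σ, by positivity, ?_⟩
  intro 𝓧 _ μ _ F G hF hG ha hb N hN ι _ θ t₀ ht₀ hθ1 hθ2
  set B := envelope F G ρ ρ
  have hB : Measurable B := measurable_envelope hF hG ρ ρ
  have hB1 : ∀ x, 1 ≤ B x := one_le_envelope hρ
  obtain ⟨hm1, hm2⟩ := hmom 𝓧 μ B hB hB1 (eLpNorm_envelope_le hp2 hF hG ha hb ρ ρ)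
  have hint := integrablePositions_of_eLpNorm_le hl hp hderiv hF hG ha hb
  set L : 𝓧 → ℝ := fun x => l (B x + 1) - l (B x) with hL_def
  have hL0 : ∀ x, 0 ≤ L x := fun x => sub_nonneg.2 (hl.monotone (by linarith))
  have hlm := hl.measurable
  have hL : Measurable L := by fun_prop
  have hBL : Measurable fun x => B x * L x := by fun_prop
  have hle : ∀ t x, |hedgedPosition F G (θ t).1 x - (θ t).2| ≤ B x := fun t x =>
    abs_hedgedPosition_sub_le_envelope (hθ1 t) (hθ2 t) x
  -- The dominating linear class: `none` carries the coefficient `-m` and `some i` the coefficient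
  -- `g i`, each function being weighted by the local Lipschitz constant `L`. The term `F` is left
  -- out because it cancels in differences.
  set v : Option (Fin e) → 𝓧 → ℝ := fun o x => L x * o.elim 1 (fun i => G i x)
  set c : ι → Option (Fin e) → ℝ := fun t o => o.elim (-(θ t).2) (fun i => (θ t).1 i)
  have hcv : ∀ t x, ∑ o, c t o * v o x = L x * (hedgedPosition F G (θ t).1 x - (θ t).2 - F x) := by
    intro t x
    have : ∀ i, (θ t).1 i * (L x * G i x) = L x * ((θ t).1 i * G i x) := fun i => by ring
    simp only [Fintype.sum_option, c, v, Option.elim_none, Option.elim_some, hedgedPosition, this,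
      ← Finset.mul_sum]
    ring
  have := lintegral_iSup_centered_le_of_linear (n := N) μ
    (fun t x => l (hedgedPosition F G (θ t).1 x - (θ t).2)) v c
    (fun t => hl.measurable.comp ((measurable_hedgedPosition hF hG _).sub_const _))
    (fun t => hint.loss _ _)
    (fun o => by cases o <;> simp only [v, Option.elim_none, Option.elim_some] <;> fun_prop)
    hσ ρ.coe_nonneg hN t₀ ?_ ?_ ?_ ?_
  · refine this.trans (le_of_eq ?_)
    congr 1
    simp only [Fintype.card_option, Fintype.card_fin]
    push_cast
    ring
  · intro s t x
    refine (hl.abs_sub_le ((le_abs_self _).trans (hle s x)) ((le_abs_self _).trans (hle t x))).trans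
      (le_of_eq ?_)
    rw [hcv, hcv, ← mul_sub, abs_mul, abs_of_nonneg (hL0 x)]
    congr 2
    ring
  · rintro t (_ | i)
    · simpa [c] using hθ2 t
    · exact (PiLp.norm_apply_le (θ t).1 i).trans (hθ1 t)
  · intro o
    have := lintegral_enorm_sq_le_of_abs_le_mul (f := v o) (c := 1) hBL hm2
      (ae_of_all _ fun x => ?_)
    · simpa using this
    · rw [one_mul, abs_mul, abs_of_nonneg (hL0 x), mul_comm]
      refine mul_le_mul_of_nonneg_right ?_ (hL0 x)
      cases o with
      | none => simpa using hB1 x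
      | some i => exact abs_le_envelope hρ i x
  · have := lintegral_enorm_sq_le_of_abs_le_mul
      (f := fun x => l (hedgedPosition F G (θ t₀).1 x - (θ t₀).2)) (c := 1)
      (hl.measurable.comp hB) hm1 (ae_of_all _ fun x => ?_)
    · simpa using this
    · rw [one_mul, abs_of_nonneg (hl.nonneg _)]
      exact hl.monotone ((le_abs_self _).trans (hle t₀ x))

/-- The uniform deviation of expected losses over `‖g‖ ≤ ρ`, `|m| ≤ ρ`. -/
noncomputable def lossDeviation {𝓧 : Type*} [MeasurableSpace 𝓧] {e : ℕ} (l : ℝ → ℝ)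
    (μ ν : Measure 𝓧) (F : 𝓧 → ℝ) (G : Fin e → 𝓧 → ℝ) (ρ : ℝ≥0) : ℝ≥0∞ :=
  ⨆ t ∈ {t : EuclideanSpace ℝ (Fin e) × ℝ | ‖t.1‖ ≤ ρ ∧ |t.2| ≤ ρ},
    ‖expectedLoss l μ F G t - expectedLoss l ν F G t‖ₑ

lemma exists_lintegral_lossDeviation_le {l : ℝ → ℝ} (hl : IsLossFunction l) {p : ℝ≥0∞}
    (hp : 1 ≤ p) (hderiv : DerivHasPolynomialGrowth l p) (e : ℕ) (a b ρ : ℝ≥0) (hρ : 1 ≤ ρ) :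
    ∃ C : ℝ, 0 < C ∧ ∀ (𝓧 : Type*) [MeasurableSpace 𝓧] (μ : Measure 𝓧) [IsProbabilityMeasure μ]
      (F : 𝓧 → ℝ) (G : Fin e → 𝓧 → ℝ), Measurable F → (∀ i, Measurable (G i)) →
      eLpNorm F (2 * p) μ ≤ a → eLpNorm (fun x => ∑ i, |G i x|) (2 * p) μ ≤ b →
      ∀ (N : ℕ), 1 ≤ N →
      ∫⁻ x, lossDeviation l μ (empiricalMeasure x) F G ρ ∂(Measure.pi fun _ : Fin N => μ) ≤
        ENNReal.ofReal (C / √N) := by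
  obtain ⟨C, hC, hmax⟩ := exists_finite_loss_maximal_bound hl hp hderiv e a b ρ hρ
  refine ⟨C, hC, fun 𝓧 _ μ _ F G hF hG ha hb N hN => ?_⟩
  have hint := integrablePositions_of_eLpNorm_le hl hp hderiv hF hG ha hb
  set T := {t : EuclideanSpace ℝ (Fin e) × ℝ | ‖t.1‖ ≤ ρ ∧ |t.2| ≤ ρ}
  have h0T : (0 : EuclideanSpace ℝ (Fin e) × ℝ) ∈ T := by simp [T]
  have hN0 : (0 : ℝ) < N := by exact_mod_cast hN
  obtain ⟨D, hDs, hDc, hD⟩ :=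
    (TopologicalSpace.IsSeparable.of_separableSpace T).exists_countable_dense_subset
  have hDne : D.Nonempty := closure_nonempty_iff.1 ⟨0, hD h0T⟩
  obtain ⟨u, rfl⟩ := hDc.exists_eq_range hDne
  have huT : ∀ k, u k ∈ T := fun k => hDs (mem_range_self k)
  have hm : ∀ t : EuclideanSpace ℝ (Fin e) × ℝ,
      Measurable fun y => l (hedgedPosition F G t.1 y - t.2) := fun t =>
    hl.measurable.comp ((measurable_hedgedPosition hF hG _).sub_const _)
  have hdev : ∀ (x : Fin N → 𝓧) (t : EuclideanSpace ℝ (Fin e) × ℝ),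
      ‖expectedLoss l μ F G t - expectedLoss l (empiricalMeasure x) F G t‖ₑ =
        ENNReal.ofReal (N : ℝ)⁻¹ * ‖∑ i, (l (hedgedPosition F G t.1 (x i) - t.2) -
        expectedLoss l μ F G t)‖ₑ := by
    intro x t
    have : expectedLoss l (empiricalMeasure x) F G t =
        (N : ℝ)⁻¹ * ∑ i, l (hedgedPosition F G t.1 (x i) - t.2) :=
      integral_empiricalMeasure (hm t) x
    rw [this, ← Real.enorm_of_nonneg (inv_nonneg.2 hN0.le), ← enorm_mul, ← enorm_neg]
    congr 1
    simp only [Finset.sum_sub_distrib, Finset.sum_const, Finset.card_univ, Fintype.card_fin,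
      nsmul_eq_mul, mul_sub]
    field_simp
    ring
  -- Suprema over the first `n` points of a dense sequence; the finite bound does not depend on `n`,
  -- so it passes to the limit by monotone convergence.
  set f : ℕ → (Fin N → 𝓧) → ℝ≥0∞ := fun n x => ⨆ k : Fin n,
    ‖∑ i, (l (hedgedPosition F G (u k).1 (x i) - (u k).2) - expectedLoss l μ F G (u k))‖ₑ with hf
  have hfm : ∀ n, Measurable (f n) := fun n => by
    refine .iSup fun k => Measurable.enorm (Finset.measurable_sum _ fun i _ => ?_)
    exact ((hm (u k)).comp (measurable_pi_apply i)).sub_const _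
  have hfmono : Monotone f := fun n m hnm x => iSup_le fun k =>
    le_iSup (fun k : Fin m => ‖∑ i, (l (hedgedPosition F G (u k).1 (x i) - (u k).2) -
      expectedLoss l μ F G (u k))‖ₑ) (Fin.castLE hnm k)
  have hfint : ∀ n, ∫⁻ x, f n x ∂(Measure.pi fun _ : Fin N => μ) ≤ ENNReal.ofReal (C * √N) := by
    intro n
    -- `Option` adjoins the parameter `0`, the base point required by the finite maximal inequality,
    -- which need not occur in the sequence.
    refine le_trans (lintegral_mono fun x => iSup_le fun k => ?_)
      (hmax 𝓧 μ F G hF hG ha hb N hN (Option (Fin n)) (fun o => o.elim 0 fun k => u k) none rfl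
        ?_ ?_)
    · exact le_iSup (fun o : Option (Fin n) => ‖∑ i, (l (hedgedPosition F G
        (o.elim 0 fun k => u k : EuclideanSpace ℝ (Fin e) × ℝ).1 (x i) -
        (o.elim 0 fun k => u k : EuclideanSpace ℝ (Fin e) × ℝ).2) -
        expectedLoss l μ F G (o.elim 0 fun k => u k))‖ₑ) (some k)
    · rintro (_ | k)
      · exact h0T.1
      · exact (huT k).1
    · rintro (_ | k)
      · exact h0T.2
      · exact (huT k).2
  have hZ : ∀ x : Fin N → 𝓧, lossDeviation l μ (empiricalMeasure x) F G ρ ≤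
      ENNReal.ofReal (N : ℝ)⁻¹ * ⨆ n, f n x := by
    intro x
    have := isProbabilityMeasure_empiricalMeasure hN x
    have hc1 := continuous_expectedLoss hl hint
    have hc2 := continuous_expectedLoss hl (integrablePositions_empiricalMeasure hl hF hG hN x)
    rw [lossDeviation, iSup_mem_eq_of_subset_closure (by fun_prop) hDs hD]
    refine iSup₂_le ?_
    rintro _ ⟨k, rfl⟩
    rw [hdev]
    gcongr
    exact le_iSup_of_le (k + 1) (le_iSup (fun k : Fin _ => ‖∑ i, (l (hedgedPosition F G (u k).1
      (x i) - (u k).2) - expectedLoss l μ F G (u k))‖ₑ) (Fin.last k))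
  calc _ ≤ ∫⁻ x, ENNReal.ofReal (N : ℝ)⁻¹ * ⨆ n, f n x ∂(Measure.pi fun _ : Fin N => μ) :=
        lintegral_mono hZ
    _ = ENNReal.ofReal (N : ℝ)⁻¹ * ⨆ n, ∫⁻ x, f n x ∂(Measure.pi fun _ : Fin N => μ) := by
        rw [lintegral_const_mul _ (.iSup hfm), lintegral_iSup hfm hfmono]
    _ ≤ ENNReal.ofReal (N : ℝ)⁻¹ * ENNReal.ofReal (C * √N) := by
        gcongr
        exact iSup_le hfint
    _ = _ := by
        rw [← ENNReal.ofReal_mul (by positivity)]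
        congr 1
        have := Real.sq_sqrt hN0.le
        field_simp
        linarith

/-! ### Confining the optimal `m` to a bounded interval. -/

lemma IsLossFunction.exists_affine_le {l : ℝ → ℝ} (hl : IsLossFunction l)
    (h : 1 < liminf (fun x : ℝ => ((l x / x : ℝ) : EReal)) atTop) :
    ∃ δ c : ℝ, 0 < δ ∧ 0 ≤ c ∧ ∀ x, (1 + δ) * x - c ≤ l x := by
  obtain ⟨b, hb1, hb⟩ := EReal.lt_iff_exists_real_btwn.1 h
  have hb1' : 1 < b := by exact_mod_cast hb1
  obtain ⟨x₀, hx₀⟩ := eventually_atTop.1 (eventually_lt_of_lt_liminf hb)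
  refine ⟨b - 1, b * |x₀|, by linarith, by positivity, fun x => ?_⟩
  rw [add_sub_cancel]
  rcases le_or_gt x |x₀| with hx | hx
  · nlinarith [hl.nonneg x]
  · have h1 : b < l x / x := EReal.coe_lt_coe_iff.1 (hx₀ x ((le_abs_self x₀).trans hx.le))
    have h2 : 0 < x := (abs_nonneg x₀).trans_lt hx
    rw [lt_div_iff₀ h2] at h1
    nlinarith [abs_nonneg x₀]

section Localization

variable {𝓧 : Type*} [MeasurableSpace 𝓧] {e : ℕ} {l : ℝ → ℝ} {F : 𝓧 → ℝ} {G : Fin e → 𝓧 → ℝ}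

/-- The infimum defining the certainty equivalent of `F + g · G` may be restricted to `|m| ≤ ρ`. -/
def HasBoundedOptimizers (l : ℝ → ℝ) (ν : Measure 𝓧) (F : 𝓧 → ℝ) (G : Fin e → 𝓧 → ℝ)
    (g : EuclideanSpace ℝ (Fin e)) (ρ : ℝ≥0) : Prop :=
  ∀ m : ℝ, ∃ m' : ℝ, |m'| ≤ ρ ∧ expectedLoss l ν F G (g, m') + m' ≤ expectedLoss l ν F G (g, m) + m

/-- Any `m` can be replaced by one in the bounded range that is no worse for `ν` and then tested
against `ν'`; only deviations on that range matter. -/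
lemma realOCE_le_add {ν ν' : Measure 𝓧} [IsProbabilityMeasure ν'] (hl : IsLossFunction l)
    (h' : IntegrablePositions l ν' F G) {g : EuclideanSpace ℝ (Fin e)} {ρ : ℝ≥0} {d : ℝ}
    (hb : HasBoundedOptimizers l ν F G g ρ)
    (hd : ∀ m : ℝ, |m| ≤ ρ →
      expectedLoss l ν' F G (g, m) ≤ expectedLoss l ν F G (g, m) + d) :
    realOCE l ν' F G g ≤ realOCE l ν F G g + d := by
  rw [← sub_le_iff_le_add]
  refine le_ciInf fun m => ?_
  obtain ⟨m', hm', hle⟩ := hb m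
  linarith [realOCE_le hl h' g m', hd m' hm']

lemma enorm_realOCE_sub_le {ν ν' : Measure 𝓧} [IsProbabilityMeasure ν] [IsProbabilityMeasure ν']
    (hl : IsLossFunction l) (h : IntegrablePositions l ν F G) (h' : IntegrablePositions l ν' F G)
    {g : EuclideanSpace ℝ (Fin e)} {ρ : ℝ≥0} (hg : ‖g‖ ≤ ρ)
    (hb : HasBoundedOptimizers l ν F G g ρ) (hb' : HasBoundedOptimizers l ν' F G g ρ) :
    ‖realOCE l ν F G g - realOCE l ν' F G g‖ₑ ≤ lossDeviation l ν ν' F G ρ := by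
  rcases eq_or_ne (lossDeviation l ν ν' F G ρ) ∞ with htop | htop
  · simp [htop]
  have hd : ∀ m : ℝ, |m| ≤ ρ → |expectedLoss l ν F G (g, m) - expectedLoss l ν' F G (g, m)| ≤
      (lossDeviation l ν ν' F G ρ).toReal := by
    intro m hm
    rw [← ENNReal.ofReal_le_iff_le_toReal htop, ← Real.norm_eq_abs, ofReal_norm]
    exact le_iSup₂ (f := fun (t : EuclideanSpace ℝ (Fin e) × ℝ)
      (_ : t ∈ {t : EuclideanSpace ℝ (Fin e) × ℝ | ‖t.1‖ ≤ ρ ∧ |t.2| ≤ ρ}) =>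
      ‖expectedLoss l ν F G t - expectedLoss l ν' F G t‖ₑ) (g, m) ⟨hg, hm⟩
  rw [← ofReal_norm, ENNReal.ofReal_le_iff_le_toReal htop, Real.norm_eq_abs, abs_sub_le_iff]
  constructor
  · have := realOCE_le_add hl h hb' (d := (lossDeviation l ν ν' F G ρ).toReal) fun m hm => by
      linarith [(abs_le.1 (hd m hm)).2]
    linarith
  · have := realOCE_le_add hl h' hb (d := (lossDeviation l ν ν' F G ρ).toReal) fun m hm => by
      linarith [(abs_le.1 (hd m hm)).1]
    linarith

variable {ν : Measure 𝓧} {S : 𝓧 → ℝ} {c₁ : ℝ} {g : EuclideanSpace ℝ (Fin e)}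

lemma expectedLoss_zero_le (h : IntegrablePositions l ν F G) (hS : Integrable S ν)
    (hlS : ∀ x, l (hedgedPosition F G g x) ≤ c₁ * S x) :
    expectedLoss l ν F G (g, 0) ≤ c₁ * ∫ x, S x ∂ν := by
  rw [← integral_const_mul]
  exact integral_mono (h.loss g 0) (hS.const_mul _) fun x => by simpa using hlS x

lemma abs_integral_position_le (hS : Integrable S ν)
    (hgS : ∀ x, |hedgedPosition F G g x| ≤ S x) :
    |∫ x, hedgedPosition F G g x ∂ν| ≤ ∫ x, S x ∂ν :=
  norm_integral_le_of_norm_le (f := hedgedPosition F G g) hS (ae_of_all _ hgS)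

variable [IsProbabilityMeasure ν]

/-- Truncate `m` to `[-A, A]`. If `m > A`, the arguments of `l` stay nonpositive while `m` drops to
`A`, so the loss rises by at most `m - A`; if `m < -A`, they stay nonnegative while `m` rises to
`-A`, so the loss falls by at least `-A - m`. -/
lemma hasBoundedOptimizers_of_ae_bounded (hl : IsLossFunction l)
    (h : IntegrablePositions l ν F G) {A ρ : ℝ≥0}
    (hA : ∀ᵐ x ∂ν, |hedgedPosition F G g x| ≤ A) (hAρ : A ≤ ρ) :
    HasBoundedOptimizers l ν F G g ρ := by
  have hAρ' : (A : ℝ) ≤ ρ := by exact_mod_cast hAρ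
  have key : ∀ m m' : ℝ, (∀ᵐ x ∂ν, l (hedgedPosition F G g x - m') ≤
      l (hedgedPosition F G g x - m) + (m - m')) →
      expectedLoss l ν F G (g, m') + m' ≤ expectedLoss l ν F G (g, m) + m := by
    intro m m' hmm
    have := integral_mono_ae (h.loss g m') ((h.loss g m).add (integrable_const (m - m'))) hmm
    simp only [Pi.add_apply] at this
    rw [integral_add (h.loss g m) (integrable_const _)] at this
    simp only [integral_const, probReal_univ, one_smul] at this
    simp only [expectedLoss]
    linarith
  intro m
  rcases lt_or_ge (A : ℝ) m with hm | hm
  · refine ⟨A, by simpa using hAρ', key _ _ (hA.mono fun x hx => ?_)⟩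
    have := hl.sub_le_of_nonpos (x := hedgedPosition F G g x - m)
      (y := hedgedPosition F G g x - A) (by linarith) (by linarith [(abs_le.1 hx).2])
    linarith
  rcases lt_or_ge m (-(A : ℝ)) with hm' | hm'
  · refine ⟨-A, by simpa using hAρ', key _ _ (hA.mono fun x hx => ?_)⟩
    have := hl.le_sub_of_nonneg (x := hedgedPosition F G g x - -A)
      (y := hedgedPosition F G g x - m) (by linarith) (by linarith [(abs_le.1 hx).1])
    linarith
  · exact ⟨m, (abs_le.2 ⟨hm', hm⟩).trans hAρ', le_rfl⟩

/-- The certainty equivalent lies between the mean and the objective at `m = 0`. This crude bound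
handles samples for which localization fails. -/
lemma abs_realOCE_le (hl : IsLossFunction l) (h : IntegrablePositions l ν F G)
    (hc₁ : 0 ≤ c₁) (hS : Integrable S ν) (hgS : ∀ x, |hedgedPosition F G g x| ≤ S x)
    (hlS : ∀ x, l (hedgedPosition F G g x) ≤ c₁ * S x) :
    |realOCE l ν F G g| ≤ (c₁ + 1) * ∫ x, S x ∂ν := by
  have h1 := expectedLoss_zero_le h hS hlS
  have h2 := abs_integral_position_le hS hgS
  have h3 := realOCE_le hl h g 0
  have h4 : ∫ x, hedgedPosition F G g x ∂ν ≤ realOCE l ν F G g :=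
    le_ciInf fun m => integral_position_le hl h g m
  have h5 := (abs_nonneg _).trans h2
  have h6 := mul_nonneg hc₁ h5
  rw [abs_le]
  constructor <;> linarith [(abs_le.1 h2).1]

/-- Outside `[-ρ, ρ]` the choice `m' = 0` is better. For `m > ρ` nonnegativity of `l` makes the
objective exceed `c₁ * s`; for `m < -ρ` the slope `1 + δ` leaves a net gain of `δ * |m|` after
adding `m`. -/
lemma hasBoundedOptimizers_of_superlinear (hl : IsLossFunction l)
    (h : IntegrablePositions l ν F G) {δ c s : ℝ} (hδ : 0 < δ)
    (hlow : ∀ x, (1 + δ) * x - c ≤ l x) (hc₁ : 0 ≤ c₁) (hS : Integrable S ν)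
    (hgS : ∀ x, |hedgedPosition F G g x| ≤ S x)
    (hlS : ∀ x, l (hedgedPosition F G g x) ≤ c₁ * S x) (hs : ∫ x, S x ∂ν ≤ s) {ρ : ℝ≥0}
    (h1 : c₁ * s ≤ ρ) (h2 : ((1 + δ + c₁) * s + c) / δ ≤ ρ) :
    HasBoundedOptimizers l ν F G g ρ := by
  have e1 : expectedLoss l ν F G (g, 0) ≤ c₁ * s :=
    (expectedLoss_zero_le h hS hlS).trans (mul_le_mul_of_nonneg_left hs hc₁)
  have e2 := (abs_integral_position_le hS hgS).trans hs
  intro m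
  rcases le_or_gt |m| ρ with hm | hm
  · exact ⟨m, hm, le_rfl⟩
  refine ⟨0, by simp, ?_⟩
  rw [add_zero]
  rcases lt_abs.1 hm with hm | hm
  · have : 0 ≤ expectedLoss l ν F G (g, m) := integral_nonneg fun x => hl.nonneg _
    linarith
  · have e3 : (1 + δ) * (∫ x, hedgedPosition F G g x ∂ν - m) - c ≤ expectedLoss l ν F G (g, m) := by
      have hi : Integrable (fun x => (1 + δ) * (hedgedPosition F G g x - m)) ν :=
        ((h.position g).sub' (integrable_const _)).const_mul _
      have := integral_mono (hi.sub' (integrable_const c)) (h.loss g m) fun x => hlow _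
      rw [integral_sub hi (integrable_const _), integral_const_mul,
        integral_sub (h.position g) (integrable_const _)] at this
      simp only [integral_const, probReal_univ, one_smul] at this
      exact this
    have e4 : (1 + δ + c₁) * s + c < δ * (-m) := by
      have := h2.trans_lt hm
      rw [div_lt_iff₀ hδ] at this
      linarith
    have e5 := mul_le_mul_of_nonneg_left (abs_le.1 e2).1 (by linarith : 0 ≤ 1 + δ)
    linarith

end Localization

/-! ### Assembling the error bound. -/

lemma integral_le_one_add_of_lintegral_enorm_sq_le {𝓧 : Type*} [MeasurableSpace 𝓧]
    {μ : Measure 𝓧} [IsProbabilityMeasure μ] {f : 𝓧 → ℝ} {c : ℝ} (hc : 0 ≤ c)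
    (h : ∫⁻ x, ‖f x‖ₑ ^ 2 ∂μ ≤ ENNReal.ofReal c) : ∫ x, f x ∂μ ≤ 1 + c := by
  have h1 := (enorm_integral_le_lintegral_enorm f).trans (lintegral_enorm_le_one_add (μ := μ) f)
  have h2 : ‖∫ x, f x ∂μ‖ₑ ≤ ENNReal.ofReal (1 + c) := by
    rw [ENNReal.ofReal_add zero_le_one hc, ENNReal.ofReal_one]
    exact h1.trans (by gcongr)
  rw [← ofReal_norm, ENNReal.ofReal_le_ofReal_iff (by positivity)] at h2
  exact (le_abs_self _).trans h2

lemma ae_empiricalMeasure {𝓧 : Type*} [MeasurableSpace 𝓧] {N : ℕ} {x : Fin N → 𝓧} {q : 𝓧 → Prop}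
    (hq : MeasurableSet {y | q y}) (h : ∀ i, q (x i)) : ∀ᵐ y ∂(empiricalMeasure x), q y := by
  refine Measure.ae_smul_measure ?_ _
  rw [ae_finsetSum_measure_iff]
  exact fun i _ => (ae_dirac_iff hq).2 (h i)

/-- The error of the certainty equivalents is controlled by deviations of expected losses over a
bounded set of parameters, and the deviation of the empirical mean of a single function. -/
lemma exists_realOCE_error_bound {l : ℝ → ℝ} (hl : IsLossFunction l) {p : ℝ≥0∞} (hp : 1 ≤ p)
    (hgrowth : p ≠ ∞ → 1 < liminf (fun x : ℝ => ((l x / x : ℝ) : EReal)) atTop)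
    (hderiv : DerivHasPolynomialGrowth l p) (e : ℕ) (R : ℝ) (a b : ℝ≥0) :
    ∃ (ρ : ℝ≥0) (C σ : ℝ), 1 ≤ ρ ∧ 0 ≤ C ∧ 0 < σ ∧
      ∀ (𝓧 : Type*) [MeasurableSpace 𝓧] (μ : Measure 𝓧) [IsProbabilityMeasure μ]
        (F : 𝓧 → ℝ) (G : Fin e → 𝓧 → ℝ), Measurable F → (∀ i, Measurable (G i)) →
        eLpNorm F (2 * p) μ ≤ a → eLpNorm (fun x => ∑ i, |G i x|) (2 * p) μ ≤ b →
        ∃ S : 𝓧 → ℝ, Measurable S ∧ Integrable S μ ∧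
          ∫⁻ x, ‖S x‖ₑ ^ 2 ∂μ ≤ ENNReal.ofReal (σ ^ 2) ∧
          ∀ (N : ℕ), 1 ≤ N → ∀ᵐ x ∂(Measure.pi fun _ : Fin N => μ), ∀ g, ‖g‖ ≤ R →
            ‖realOCE l μ F G g - realOCE l (empiricalMeasure x) F G g‖ₑ ≤
              lossDeviation l μ (empiricalMeasure x) F G ρ +
                ENNReal.ofReal C * ‖∫ y, S y ∂(empiricalMeasure x) - ∫ y, S y ∂μ‖ₑ := by
  have hp2 : 1 ≤ 2 * p := hp.trans (le_mul_of_one_le_left zero_le one_le_two)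
  set r := R.toNNReal
  have hr : ∀ {g : EuclideanSpace ℝ (Fin e)}, ‖g‖ ≤ R → ‖g‖ ≤ r := fun h =>
    h.trans (Real.le_coe_toNNReal R)
  set A := a + r * b + 1
  have henv : ∀ {𝓧 : Type _} {F : 𝓧 → ℝ} {G : Fin e → 𝓧 → ℝ} {g : EuclideanSpace ℝ (Fin e)},
      ‖g‖ ≤ R → ∀ x, |hedgedPosition F G g x| ≤ envelope F G r 1 x := fun hg x => by
    simpa using abs_hedgedPosition_sub_le_envelope (c := 1) (m := 0) (hr hg) (by simp) x
  rcases eq_or_ne p ∞ with rfl | hp'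
  -- For `p = ∞` almost every sample lies where the envelope is at most `A`, so localization never
  -- fails and the correction term is trivial: `C = 0`, `S = 0`, and `σ = 1` is arbitrary.
  · refine ⟨r + A, 0, 1, le_add_self.trans (add_le_add_right (le_add_self) r), le_rfl, one_pos, ?_⟩
    intro 𝓧 _ μ _ F G hF hG ha hb
    have hint := integrablePositions_of_eLpNorm_le hl hp hderiv hF hG ha hb
    refine ⟨0, measurable_const, integrable_zero _ _ _, by simp, fun N hN => ?_⟩
    have hA := eLpNorm_envelope_le hp2 hF hG ha hb r 1
    rw [ENNReal.mul_top two_ne_zero, eLpNorm_exponent_top] at hA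
    have hae : ∀ᵐ x ∂μ, envelope F G r 1 x ≤ A := by
      filter_upwards [ae_le_eLpNormEssSup (f := envelope F G r 1) (μ := μ)] with x hx
      have := hx.trans hA
      rw [← ofReal_norm, ← ENNReal.ofReal_coe_nnreal] at this
      exact (le_abs_self _).trans ((ENNReal.ofReal_le_ofReal_iff A.2).1 this)
    have hae' : ∀ᵐ x ∂(Measure.pi fun _ : Fin N => μ), ∀ i, envelope F G r 1 (x i) ≤ A :=
      eventually_all.2 fun i =>
        (measurePreserving_eval (fun _ : Fin N => μ) i).quasiMeasurePreserving.ae hae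
    filter_upwards [hae'] with x hx g hg
    have := isProbabilityMeasure_empiricalMeasure hN x
    have hI := integrablePositions_empiricalMeasure hl hF hG hN x
    refine (enorm_realOCE_sub_le hl hint hI ((hr hg).trans (by simp)) ?_ ?_).trans le_self_add
    · exact hasBoundedOptimizers_of_ae_bounded hl hint
        (hae.mono fun y hy => (henv hg y).trans hy) le_add_self
    · refine hasBoundedOptimizers_of_ae_bounded (A := A) hl hI ?_ le_add_self
      exact ae_empiricalMeasure (measurableSet_le (measurable_hedgedPosition hF hG g).abs
        measurable_const) fun i => (henv hg _).trans (hx i)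
  · obtain ⟨δ, c, hδ, hc, hlow⟩ := hl.exists_affine_le (hgrowth hp')
    obtain ⟨K, hK⟩ := hderiv hp'
    have hq : 1 ≤ p.toReal := by
      rw [← ENNReal.toReal_one]
      exact ENNReal.toReal_mono hp' hp
    set q := p.toReal
    set c₁ := l 0 + 2 * |K|
    have hc₁ : 0 ≤ c₁ := by have := hl.nonneg 0; positivity
    set σ := (A : ℝ) ^ q + 1
    have hσ : 0 < σ := by positivity
    set s₀ := 1 + σ ^ 2
    have hs₀ : 0 < s₀ := by positivity
    -- The two thresholds of `hasBoundedOptimizers_of_superlinear` at `s = s₀ + 1`: here `s₀` bounds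
    -- `∫ S dμ`, and the extra `1` allows for the empirical mean when `|D| ≤ 1`.
    set t₁ := c₁ * (s₀ + 1)
    set t₂ := ((1 + δ + c₁) * (s₀ + 1) + c) / δ
    have ht₁ : 0 ≤ t₁ := by positivity
    have ht₂ : 0 ≤ t₂ := by positivity
    set ρ : ℝ≥0 := r + 1 + ⟨t₁, ht₁⟩ + ⟨t₂, ht₂⟩
    have hρ : (ρ : ℝ) = r + 1 + t₁ + t₂ := rfl
    have hr0 := r.coe_nonneg
    refine ⟨ρ, (c₁ + 1) * (2 * s₀ + 1), σ, ?_, by positivity, hσ, ?_⟩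
    · rw [← NNReal.coe_le_coe, hρ]
      push_cast
      linarith
    intro 𝓧 _ μ _ F G hF hG ha hb
    have hint := integrablePositions_of_eLpNorm_le hl hp hderiv hF hG ha hb
    set W := envelope F G r 1
    have hW1 : ∀ x, 1 ≤ W x := one_le_envelope le_rfl
    have hW : Measurable W := measurable_envelope hF hG r 1
    have hSm : Measurable fun x => W x ^ q := by fun_prop
    have hS2 : ∫⁻ x, ‖W x ^ q‖ₑ ^ 2 ∂μ ≤ ENNReal.ofReal (σ ^ 2) :=
      (lintegral_enorm_rpow_sq_le (fun x => zero_le_one.trans (hW1 x)) hp hp'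
        (eLpNorm_envelope_le hp2 hF hG ha hb r 1)).trans
        (ENNReal.ofReal_le_ofReal (by gcongr; linarith))
    have hSi := integrable_of_lintegral_enorm_sq_le hSm hS2
    refine ⟨fun x => W x ^ q, hSm, hSi, hS2, fun N hN => ae_of_all _ fun x g hg => ?_⟩
    have := isProbabilityMeasure_empiricalMeasure hN x
    have hI := integrablePositions_empiricalMeasure hl hF hG hN x
    have hSe := integrable_empiricalMeasure hN hSm x
    have hgS : ∀ y, |hedgedPosition F G g y| ≤ W y ^ q := fun y =>
      (henv hg y).trans (Real.self_le_rpow_of_one_le (hW1 y) hq)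
    have hlS : ∀ y, l (hedgedPosition F G g y) ≤ c₁ * W y ^ q := fun y =>
      (hl.monotone ((le_abs_self _).trans (henv hg y))).trans (hl.le_mul_rpow hq hK (hW1 y))
    have hsμ : ∫ y, W y ^ q ∂μ ≤ s₀ :=
      integral_le_one_add_of_lintegral_enorm_sq_le (sq_nonneg σ) hS2
    set D := ∫ y, W y ^ q ∂(empiricalMeasure x) - ∫ y, W y ^ q ∂μ with hD
    rcases le_or_gt |D| 1 with hD1 | hD1
    · refine (enorm_realOCE_sub_le hl hint hI ?_ ?_ ?_).trans le_self_add
      · rw [hρ]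
        linarith [hr hg]
      · exact hasBoundedOptimizers_of_superlinear hl hint hδ hlow hc₁ hSi hgS hlS
          (hsμ.trans (by linarith : s₀ ≤ s₀ + 1)) (by rw [hρ]; linarith) (by rw [hρ]; linarith)
      · exact hasBoundedOptimizers_of_superlinear hl hI hδ hlow hc₁ hSe hgS hlS (s := s₀ + 1)
          (by linarith [le_abs_self D]) (by rw [hρ]; linarith) (by rw [hρ]; linarith)
    -- For `|D| > 1` the two means of `S` sum to at most `2 * s₀ + |D| ≤ (2 * s₀ + 1) * |D|`, so the
    -- crude bounds are already linear in `|D|`.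
    · refine le_trans ?_ le_add_self
      have h1 := abs_realOCE_le hl hint hc₁ hSi hgS hlS
      have h2 := abs_realOCE_le hl hI hc₁ hSe hgS hlS
      rw [← ofReal_norm, ← ofReal_norm, ← ENNReal.ofReal_mul (by positivity), Real.norm_eq_abs,
        Real.norm_eq_abs]
      refine ENNReal.ofReal_le_ofReal ((abs_sub _ _).trans ((add_le_add h1 h2).trans ?_))
      rw [← mul_add, mul_assoc]
      refine mul_le_mul_of_nonneg_left ?_ (by positivity)
      nlinarith [le_abs_self D]

lemma lintegral_enorm_integral_empiricalMeasure_sub_le {𝓧 : Type*} [MeasurableSpace 𝓧]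
    (μ : Measure 𝓧) [IsProbabilityMeasure μ] {S : 𝓧 → ℝ} (hS : Measurable S)
    (hi : Integrable S μ) {σ : ℝ} (hσ : 0 < σ) {N : ℕ} (hN : 1 ≤ N)
    (h2 : ∫⁻ x, ‖S x‖ₑ ^ 2 ∂μ ≤ ENNReal.ofReal (σ ^ 2)) :
    ∫⁻ x, ‖∫ y, S y ∂(empiricalMeasure x) - ∫ y, S y ∂μ‖ₑ ∂(Measure.pi fun _ : Fin N => μ) ≤
      ENNReal.ofReal (4 * σ / √N) := by
  have hN0 : (0 : ℝ) < N := by exact_mod_cast hN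
  have key : ∀ x : Fin N → 𝓧, ‖∫ y, S y ∂(empiricalMeasure x) - ∫ y, S y ∂μ‖ₑ =
      ENNReal.ofReal (N : ℝ)⁻¹ * ‖∑ i, (S (x i) - ∫ y, S y ∂μ)‖ₑ := by
    intro x
    rw [integral_empiricalMeasure hS, ← Real.enorm_of_nonneg (inv_nonneg.2 hN0.le), ← enorm_mul]
    congr 1
    simp only [Finset.sum_sub_distrib, Finset.sum_const, Finset.card_univ, Fintype.card_fin,
      nsmul_eq_mul, mul_sub]
    field_simp
  simp_rw [key]
  rw [lintegral_const_mul _ (by fun_prop)]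
  calc _ ≤ ENNReal.ofReal (N : ℝ)⁻¹ * ENNReal.ofReal (4 * (√N * σ)) := by
        gcongr
        exact lintegral_centered_le μ hS hi hσ hN h2
    _ = _ := by
        rw [← ENNReal.ofReal_mul (by positivity)]
        congr 1
        have := Real.sq_sqrt hN0.le
        field_simp
        linarith

theorem mainTheorem2 (l : ℝ → ℝ) (hl : IsLossFunction l) (p : ℝ≥0∞) (hp : 1 ≤ p)
    (hgrowth : p ≠ ∞ → 1 < liminf (fun x : ℝ => ((l x / x : ℝ) : EReal)) atTop)
    (hderiv : DerivHasPolynomialGrowth l p) (e : ℕ) (R : ℝ) (a b : ℝ≥0) :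
    ∃ C : ℝ, 0 < C ∧
      ∀ (𝓧 : Type*) [MeasurableSpace 𝓧] (μ : Measure 𝓧) [IsProbabilityMeasure μ]
        (F : 𝓧 → ℝ) (G : Fin e → 𝓧 → ℝ) (𝓖 : Set (EuclideanSpace ℝ (Fin e))),
        Measurable F → (∀ i, Measurable (G i)) →
        eLpNorm F (2 * p) μ ≤ a →
        eLpNorm (fun x => ∑ i, |G i x|) (2 * p) μ ≤ b →
        (∀ g ∈ 𝓖, ‖g‖ ≤ R) →
        ∀ (Ω : Type*) [MeasurableSpace Ω] (P : Measure Ω) [IsProbabilityMeasure P]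
          (N : ℕ) (X : Fin N → Ω → 𝓧), 1 ≤ N →
          (∀ n, Measurable (X n)) → iIndepFun X P → (∀ n, P.map (X n) = μ) →
          Measurable (fun ω => oceError l μ (empiricalMeasure fun n => X n ω) F G 𝓖) ∧
          ∫⁻ ω, oceError l μ (empiricalMeasure fun n => X n ω) F G 𝓖 ∂P
            ≤ ENNReal.ofReal (C / √(N : ℝ)) := by
  obtain ⟨ρ, C₁, σ, hρ, hC₁, hσ, herr⟩ := exists_realOCE_error_bound hl hp hgrowth hderiv e R a b
  obtain ⟨C₂, hC₂, hdev⟩ := exists_lintegral_lossDeviation_le hl hp hderiv e a b ρ hρ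
  refine ⟨C₂ + C₁ * (4 * σ), by positivity, ?_⟩
  intro 𝓧 _ μ _ F G 𝓖 hF hG ha hb h𝓖 Ω _ P _ N X hN hX hind hlaw
  have hint := integrablePositions_of_eLpNorm_le hl hp hderiv hF hG ha hb
  have hmeas := measurable_oceError hl hF hG hN hint 𝓖
  have hXm : Measurable fun ω n => X n ω := measurable_pi_lambda _ hX
  refine ⟨hmeas.comp hXm, ?_⟩
  -- Independence and the common law enter only here, by transferring everything to the product
  -- measure.
  have hmap : P.map (fun ω n => X n ω) = Measure.pi fun _ => μ := by
    rw [hind.map_fun_eq_pi_map fun n => (hX n).aemeasurable]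
    simp_rw [hlaw]
  obtain ⟨S, hS, hSi, hS2, hbound⟩ := herr 𝓧 μ F G hF hG ha hb
  have hSm : Measurable fun x : Fin N → 𝓧 =>
      ‖∫ y, S y ∂(empiricalMeasure x) - ∫ y, S y ∂μ‖ₑ := by
    simp_rw [integral_empiricalMeasure hS]
    fun_prop
  calc _ = ∫⁻ x, oceError l μ (empiricalMeasure x) F G 𝓖 ∂(Measure.pi fun _ : Fin N => μ) := by
        rw [← hmap, lintegral_map hmeas hXm]
    _ ≤ ∫⁻ x, (lossDeviation l μ (empiricalMeasure x) F G ρ + ENNReal.ofReal C₁ *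
          ‖∫ y, S y ∂(empiricalMeasure x) - ∫ y, S y ∂μ‖ₑ) ∂(Measure.pi fun _ : Fin N => μ) := by
        refine lintegral_mono_ae ((hbound N hN).mono fun x hx => ?_)
        have := isProbabilityMeasure_empiricalMeasure hN x
        rw [oceError_eq hl hint (integrablePositions_empiricalMeasure hl hF hG hN x)]
        exact iSup₂_le fun g hg => hx g (h𝓖 g hg)
    _ = ∫⁻ x, lossDeviation l μ (empiricalMeasure x) F G ρ ∂(Measure.pi fun _ : Fin N => μ) +
          ENNReal.ofReal C₁ * ∫⁻ x, ‖∫ y, S y ∂(empiricalMeasure x) - ∫ y, S y ∂μ‖ₑ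
            ∂(Measure.pi fun _ : Fin N => μ) := by
        -- Only the second summand has to be measurable, so measurability of `lossDeviation` in the
        -- sample is never needed.
        rw [lintegral_add_right _ (hSm.const_mul _), lintegral_const_mul _ hSm]
    _ ≤ ENNReal.ofReal (C₂ / √N) + ENNReal.ofReal C₁ * ENNReal.ofReal (4 * σ / √N) := by
        gcongr
        · exact hdev 𝓧 μ F G hF hG ha hb N hN
        · exact lintegral_enorm_integral_empiricalMeasure_sub_le μ hS hSi hσ hN hS2
    _ = _ := by
        rw [← ENNReal.ofReal_mul hC₁, ← ENNReal.ofReal_add (by positivity) (by positivity)]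
        congr 1
        ring
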